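/- Let $\Bbbk$ be a field. Let $\mathrm{Flex}$ be the binary quadratic operad of flexible algebras, that is, of algebras with one bilinear operation satisfying the multilinear identity $(a,b,c)=-(c,b,a)$, where $(a,b,c)=(ab)c-a(bc)$, and let $\mathrm{anti}\text{-}\mathrm{Flex}$ be the operad of anti-flexible algebras, defined by $(a,b,c)=(c,b,a)$. For $\mathrm{Var}\in\{\mathrm{Flex},\ \mathrm{anti}\text{-}\mathrm{Flex}\}$ let $\mathrm{noncom}\text{-}\mathrm{Var}$ denote the white Manin product $\mathrm{As}\circ\mathrm{Var}$ with the associative operad, regarded as a nonsymmetric operad: the quotient of the free nonsymmetric operad over $\Bbbk$ generated by two binary operations $\prec,\succ$ by the operadic ideal generated by all elements of arity $3$ that vanish in $\mathrm{As}(3)\otimes\mathrm{Var}(3)$ under \[ x_1\prec x_2\mapsto x_1x_2\otimes x_1x_2,\qquad x_1\succ x_2\mapsto x_1x_2\otimes x_2x_1 . \] (Explicitly, these relations are spanned by the single relation \[ (x_1\succ x_2)\succ x_3-x_1\succ(x_2\succ x_3)=\varepsilon\bigl((x_1\prec x_2)\prec x_3-x_1\prec(x_2\prec x_3)\bigr),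 \] with $\varepsilon=1$ for $\mathrm{Flex}$ and $\varepsilon=-1$ for $\mathrm{anti}\text{-}\mathrm{Flex}$.) Then for every $n\ge 1$ \[ \dim\bigl(\mathrm{noncom}\text{-}\mathrm{Flex}(n)\bigr)=\frac1n\binom{3n-2}{n-1}=\frac{(3n-2)!}{n!\,(2n-1)!}, \] and likewise \[ \dim\bigl(\mathrm{noncom}\text{-}\mathrm{anti}\text{-}\mathrm{Flex}(n)\bigr)=\frac1n\binom{3n-2}{n-1}=\frac{(3n-2)!}{n!\,(2n-1)!}. \] -/

import Mathlib

open scoped TensorProduct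

/-! ### The free nonsymmetric operad on a set of binary operations -/

/-- Planar binary trees whose internal vertices are labelled by `I`: the tree monomials of the free
nonsymmetric operad generated by the set `I` of binary operations. -/
inductive PlanarTree (I : Type) : Type
  | leaf : PlanarTree I
  | node (o : I) (l r : PlanarTree I) : PlanarTree I

namespace PlanarTree

variable {I : Type}

/-- The number of leaves. -/
def arity : PlanarTree I → ℕ
  | leaf => 1
  | node _ l r => l.arity + r.arity

/-- `graft t i s` glues the root of `s` to the leaf number `i` of `t`. The leaves are numbered from
left to right, starting from `0`; only the values for `i < t.arity` are used. -/
def graft : PlanarTree I → ℕ → PlanarTree I → PlanarTree I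
  | leaf, _, s => s
  | node o l r, i, s =>
      if i < l.arity then node o (l.graft i s) r else node o l (r.graft (i - l.arity) s)

theorem arity_pos (t : PlanarTree I) : 0 < t.arity := by
  induction t with
  | leaf => simp [arity]
  | node o l r hl hr => simp only [arity]; omega

theorem arity_graft (t s : PlanarTree I) (i : ℕ) (hi : i < t.arity) :
    (t.graft i s).arity = t.arity + s.arity - 1 := by
  induction t generalizing i with
  | leaf => simp [graft, arity]
  | node o l r hl hr =>
    simp only [arity] at hi
    have h1 := l.arity_pos
    have h2 := r.arity_pos
    simp only [graft]
    split_ifs with h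
    · simp only [arity, hl i h]; omega
    · simp only [arity, hr (i - l.arity) (by omega)]; omega

/-- The value of a tree when the vertices labelled by `o` act by the binary operation `μ o` and the
leaves are replaced, from left to right, by the entries of `v`. -/
def eval {A : Type*} (μ : I → A → A → A) : (t : PlanarTree I) → (Fin t.arity → A) → A
  | leaf, v => v ⟨0, Nat.one_pos⟩
  | node o l r, v =>
      μ o (l.eval μ fun i => v (Fin.castAdd r.arity i)) (r.eval μ fun i => v (Fin.natAdd l.arity i))

end PlanarTree

/-- Tree monomials of arity `n`. -/
abbrev TreeMonomial (I : Type) (n : ℕ) : Type := {t : PlanarTree I // t.arity = n}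

/-- The arity `n` component of the free nonsymmetric operad over `k` generated by the binary
operations `I`. -/
noncomputable abbrev FreeNS (k : Type*) [Field k] (I : Type) (n : ℕ) : Type _ := TreeMonomial I n →₀ k

/-- Partial composition `t ∘ᵢ s` of tree monomials. -/
def TreeMonomial.comp {I : Type} {m n : ℕ} (i : Fin m) (t : TreeMonomial I m)
    (s : TreeMonomial I n) : TreeMonomial I (m + n - 1) :=
  ⟨t.1.graft i s.1, by
    have h := PlanarTree.arity_graft t.1 s.1 i (by rw [t.2]; exact i.2)
    rw [h, t.2, s.2]⟩

/-- Partial composition `f ∘ᵢ g` in the free nonsymmetric operad. -/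
noncomputable def FreeNS.comp {k : Type*} [Field k] {I : Type} {m n : ℕ} (i : Fin m) :
    FreeNS k I m →ₗ[k] FreeNS k I n →ₗ[k] FreeNS k I (m + n - 1) :=
  Finsupp.linearCombination k fun t => Finsupp.lmapDomain k k fun s => TreeMonomial.comp i t s

/-- Operadic ideals of the free nonsymmetric operad. -/
structure IsOperadicIdeal {k : Type*} [Field k] {I : Type}
    (J : (n : ℕ) → Submodule k (FreeNS k I n)) : Prop where
  comp_left : ∀ {m n : ℕ} (i : Fin m) (f : FreeNS k I m) (g : FreeNS k I n),
    f ∈ J m → FreeNS.comp i f g ∈ J (m + n - 1)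
  comp_right : ∀ {m n : ℕ} (i : Fin m) (f : FreeNS k I m) (g : FreeNS k I n),
    g ∈ J n → FreeNS.comp i f g ∈ J (m + n - 1)

/-- The arity `n` component of the smallest operadic ideal that contains the space `R` of quadratic
relations (which live in arity `3`). -/
noncomputable def quadraticIdeal {k : Type*} [Field k] {I : Type} (R : Submodule k (FreeNS k I 3)) (n : ℕ) :
    Submodule k (FreeNS k I n) :=
  ⨅ (J : (m : ℕ) → Submodule k (FreeNS k I m)) (_ : IsOperadicIdeal J) (_ : R ≤ J 3), J n

/-- The arity `n` component of the binary quadratic nonsymmetric operad with generating operations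
`I` and space of relations `R`. -/
noncomputable abbrev QuadraticNS {k : Type*} [Field k] {I : Type} (R : Submodule k (FreeNS k I 3)) (n : ℕ) :
    Type _ :=
  FreeNS k I n ⧸ quadraticIdeal R n

/-! ### The white Manin product of `As` with a variety with one binary operation -/

/-- The two operations `≺` and `≻`. -/
inductive ManinOp : Type
  | prec
  | succ

/-- The space of arity `3` relations of the binary quadratic operad `Var` with one binary
operation that is defined by the multilinear identity `f = 0` of degree `3` in the variables
`x₀, x₁, x₂`: the `S₃`-module generated by `f` in the free nonassociative algebra. -/
noncomputable def symmetricRelations {k : Type*} [Field k]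
    (f : FreeNonUnitalNonAssocAlgebra k (Fin 3)) :
    Submodule k (FreeNonUnitalNonAssocAlgebra k (Fin 3)) :=
  Submodule.span k (Set.range fun σ : Equiv.Perm (Fin 3) =>
    FreeNonUnitalNonAssocAlgebra.lift k
      (fun i => FreeNonUnitalNonAssocAlgebra.of k (σ i)) f)

/-- The operations `≺` and `≻` on the factor `As`: both are the associative product. -/
def asOp {A : Type*} [Mul A] : ManinOp → A → A → A
  | _, a, b => a * b

/-- The operations `≺` and `≻` on the factor `Var`: the product and the opposite product. -/
def varOp {A : Type*} [Mul A] : ManinOp → A → A → A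
  | .prec, a, b => a * b
  | .succ, a, b => b * a

/-- The natural projection to `As(3) ⊗ Var(3)` that is determined by
`x ≺ y = xy ⊗ xy` and `x ≻ y = xy ⊗ yx`, on the arity `3` component of the free nonsymmetric operad
generated by `≺` and `≻`. Here `As(3)` and `Var(3)` are realized inside the free associative
algebra and inside the free nonassociative algebra modulo the degree `3` relations of `Var`. -/
noncomputable def maninProjection {k : Type*} [Field k]
    (f : FreeNonUnitalNonAssocAlgebra k (Fin 3)) :
    FreeNS k ManinOp 3 →ₗ[k]
      FreeAlgebra k (Fin 3) ⊗[k]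
        (FreeNonUnitalNonAssocAlgebra k (Fin 3) ⧸ symmetricRelations f) :=
  Finsupp.linearCombination k fun t =>
    t.1.eval asOp (fun i => FreeAlgebra.ι k (Fin.cast t.2 i)) ⊗ₜ[k]
      (symmetricRelations f).mkQ
        (t.1.eval varOp fun i => FreeNonUnitalNonAssocAlgebra.of k (Fin.cast t.2 i))

/-- The white Manin product `As ∘ Var`, as a nonsymmetric operad, for the variety `Var` with one
binary operation that is defined by the multilinear identity `f = 0` of degree `3`: the binary
quadratic operad generated by `≺` and `≻` whose relations are the elements of arity `3` that vanish
in `As(3) ⊗ Var(3)`. This is its component of arity `n`. -/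
noncomputable abbrev NonCom {k : Type*} [Field k] (f : FreeNonUnitalNonAssocAlgebra k (Fin 3)) (n : ℕ) :
    Type _ :=
  QuadraticNS (LinearMap.ker (maninProjection f)) n

/-! ### Flexible and anti-flexible algebras -/

/-- The flexible identity `(x₀, x₁, x₂) = -(x₂, x₁, x₀)`, where `(a, b, c) = (ab)c - a(bc)`. -/
noncomputable def flexIdentity (k : Type*) [Field k] : FreeNonUnitalNonAssocAlgebra k (Fin 3) :=
  let x := FreeNonUnitalNonAssocAlgebra.of k (X := Fin 3)
  associator (x 0) (x 1) (x 2) + associator (x 2) (x 1) (x 0)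

/-- The anti-flexible identity `(x₀, x₁, x₂) = (x₂, x₁, x₀)`. -/
noncomputable def antiFlexIdentity (k : Type*) [Field k] :
    FreeNonUnitalNonAssocAlgebra k (Fin 3) :=
  let x := FreeNonUnitalNonAssocAlgebra.of k (X := Fin 3)
  associator (x 0) (x 1) (x 2) - associator (x 2) (x 1) (x 0)

/-- The component of arity `n` of the nonsymmetric flexible operad. -/
noncomputable abbrev NonComFlex (k : Type*) [Field k] (n : ℕ) : Type _ := NonCom (flexIdentity k) n

/-- The component of arity `n` of the nonsymmetric anti-flexible operad. -/
noncomputable abbrev NonComAntiFlex (k : Type*) [Field k] (n : ℕ) : Type _ := NonCom (antiFlexIdentity k) n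

/-! ### The relations of the white Manin product -/

/-! Both identities have the form `(a,b,c) = e (c,b,a)` with `e = ±1`. Every tree has the same
component in `As(3)`, so the relations of the Manin product are read off in `Var(3)`; comparing
coefficients leaves one relation, `maninRelation ε` with `ε = -e`
(`ker_maninProjection_associatorIdentity`).

Suppose `ε = i²` with `i ≠ 0`, and change generators to `d = ≻ - i≺`, `p = i≺`. The terms with two
`p`'s cancel, and the relation becomes a rewriting rule for `p (d a b) c` whose other terms are `d a
(d b c)`, `d a (p b c)`, `p a (d b c)`, `d (d a b) c`, `d (p a b) c`. The leading monomial does not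
overlap itself, so the trees avoiding it should form a basis. Instead of arguing with confluence,
the proof takes the rule as a recursive definition of `p` on the span of all trees (`shift`), with
`d` the free operation. This is an algebra satisfying the relation. Evaluation at its one-leaf tree
has as kernel exactly the operadic ideal (`ker_modelEval`) and as image the span of the normal trees
(`range_modelEval`).

A square root of `ε` need not lie in the base field, but forming the ideal commutes with extension
of scalars, so the dimension may be computed over the algebraic closure
(`finrank_quadraticNS_maninRelation`). The argument never divides by `2`, hence holds in every
characteristic.

Finally, the generating series `A` of normal trees satisfies `A (1 - A)² = X`. With `T = 1/(1 - A)`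
this says `T = 1 + X T³` and `A = X T²`, and the coefficients of powers of `T` are the Fuss–Catalan
numbers (`coeff_pow_ternary`). -/

/-- The tree monomial `(x₁ o' x₂) o x₃`. -/
def leftComb {I : Type} (o o' : I) : TreeMonomial I 3 :=
  ⟨.node o (.node o' .leaf .leaf) .leaf, rfl⟩

/-- The tree monomial `x₁ o (x₂ o' x₃)`. -/
def rightComb {I : Type} (o o' : I) : TreeMonomial I 3 :=
  ⟨.node o .leaf (.node o' .leaf .leaf), rfl⟩

@[simp]
theorem leftComb_inj {I : Type} {o o' p p' : I} :
    leftComb o o' = leftComb p p' ↔ o = p ∧ o' = p' := by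
  simp [leftComb, Subtype.ext_iff]

@[simp]
theorem rightComb_inj {I : Type} {o o' p p' : I} :
    rightComb o o' = rightComb p p' ↔ o = p ∧ o' = p' := by
  simp [rightComb, Subtype.ext_iff]

@[simp]
theorem leftComb_ne_rightComb {I : Type} {o o' p p' : I} : leftComb o o' ≠ rightComb p p' := by
  simp [leftComb, rightComb, Subtype.ext_iff]

@[simp]
theorem rightComb_ne_leftComb {I : Type} {o o' p p' : I} : rightComb o o' ≠ leftComb p p' :=
  leftComb_ne_rightComb.symm

theorem PlanarTree.eq_leaf_of_arity_eq_one {I : Type} (t : PlanarTree I) (h : t.arity = 1) :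
    t = .leaf := by
  cases t with
  | leaf => rfl
  | node o l r =>
    have h1 := l.arity_pos
    have h2 := r.arity_pos
    simp only [arity] at h
    omega

theorem PlanarTree.exists_node_leaf_leaf {I : Type} (t : PlanarTree I) (h : t.arity = 2) :
    ∃ o, t = .node o .leaf .leaf := by
  cases t with
  | leaf => simp [arity] at h
  | node o l r =>
    have h1 := l.arity_pos
    have h2 := r.arity_pos
    simp only [arity] at h
    exact ⟨o, by rw [l.eq_leaf_of_arity_eq_one (by omega), r.eq_leaf_of_arity_eq_one (by omega)]⟩

theorem TreeMonomial.eq_leftComb_or_rightComb {I : Type} (t : TreeMonomial I 3) :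
    (∃ o o', t = leftComb o o') ∨ ∃ o o', t = rightComb o o' := by
  obtain ⟨t, ht⟩ := t
  cases t with
  | leaf => simp [PlanarTree.arity] at ht
  | node o l r =>
    have h1 := l.arity_pos
    have h2 := r.arity_pos
    simp only [PlanarTree.arity] at ht
    rcases (by omega : l.arity = 2 ∧ r.arity = 1 ∨ l.arity = 1 ∧ r.arity = 2) with h | h
    · obtain ⟨o', rfl⟩ := l.exists_node_leaf_leaf h.1
      obtain rfl := r.eq_leaf_of_arity_eq_one h.2
      exact Or.inl ⟨o, o', rfl⟩
    · obtain ⟨o', rfl⟩ := r.exists_node_leaf_leaf h.2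
      obtain rfl := l.eq_leaf_of_arity_eq_one h.1
      exact Or.inr ⟨o, o', rfl⟩

section Relations

variable {k : Type*} [Field k]

/-- The multiple `c t` of a tree monomial. -/
noncomputable abbrev treeSingle {I : Type} {n : ℕ} (t : TreeMonomial I n) (c : k) : FreeNS k I n :=
  Finsupp.single t c

/-- The relation `(x₁ ≻ x₂) ≻ x₃ - x₁ ≻ (x₂ ≻ x₃) = ε ((x₁ ≺ x₂) ≺ x₃ - x₁ ≺ (x₂ ≺ x₃))`. -/
noncomputable def maninRelation (ε : k) : FreeNS k ManinOp 3 :=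
  treeSingle (leftComb ManinOp.succ ManinOp.succ) 1 - treeSingle (rightComb ManinOp.succ ManinOp.succ) 1 -
    ε • (treeSingle (leftComb ManinOp.prec ManinOp.prec) 1 - treeSingle (rightComb ManinOp.prec ManinOp.prec) 1)

theorem FreeNS.eq_sum_combs (f : FreeNS k ManinOp 3) :
    f = treeSingle (leftComb ManinOp.prec ManinOp.prec) (f (leftComb ManinOp.prec ManinOp.prec)) +
        treeSingle (leftComb ManinOp.prec ManinOp.succ) (f (leftComb ManinOp.prec ManinOp.succ)) +
        treeSingle (leftComb ManinOp.succ ManinOp.prec) (f (leftComb ManinOp.succ ManinOp.prec)) +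
        treeSingle (leftComb ManinOp.succ ManinOp.succ) (f (leftComb ManinOp.succ ManinOp.succ)) +
        treeSingle (rightComb ManinOp.prec ManinOp.prec) (f (rightComb ManinOp.prec ManinOp.prec)) +
        treeSingle (rightComb ManinOp.prec ManinOp.succ) (f (rightComb ManinOp.prec ManinOp.succ)) +
        treeSingle (rightComb ManinOp.succ ManinOp.prec) (f (rightComb ManinOp.succ ManinOp.prec)) +
        treeSingle (rightComb ManinOp.succ ManinOp.succ) (f (rightComb ManinOp.succ ManinOp.succ)) := by
  classical
  ext t
  rcases t.eq_leftComb_or_rightComb with ⟨o, o', rfl⟩ | ⟨o, o', rfl⟩ <;> cases o <;> cases o' <;>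
    simp

/-- The coefficient of a nonassociative monomial. -/
noncomputable def magmaCoeff (m : FreeMagma (Fin 3)) :
    FreeNonUnitalNonAssocAlgebra k (Fin 3) →ₗ[k] k where
  toFun g := g.coeff m
  map_add' _ _ := rfl
  map_smul' _ _ := rfl

/-- The identity `(x₀, x₁, x₂) = e (x₂, x₁, x₀)`. -/
noncomputable def associatorIdentity (e : k) : FreeNonUnitalNonAssocAlgebra k (Fin 3) :=
  associator (FreeNonUnitalNonAssocAlgebra.of k 0) (FreeNonUnitalNonAssocAlgebra.of k 1)
      (FreeNonUnitalNonAssocAlgebra.of k 2) -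
    e • associator (FreeNonUnitalNonAssocAlgebra.of k 2) (FreeNonUnitalNonAssocAlgebra.of k 1)
      (FreeNonUnitalNonAssocAlgebra.of k 0)

theorem flexIdentity_eq : flexIdentity k = associatorIdentity (-1) := by
  simp [flexIdentity, associatorIdentity]

theorem antiFlexIdentity_eq : antiFlexIdentity k = associatorIdentity 1 := by
  simp [antiFlexIdentity, associatorIdentity]

theorem of_mul_of_mul_of (a b c : Fin 3) :
    FreeNonUnitalNonAssocAlgebra.of k a * FreeNonUnitalNonAssocAlgebra.of k b *
        FreeNonUnitalNonAssocAlgebra.of k c =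
      MonoidAlgebra.single (FreeMagma.of a * FreeMagma.of b * FreeMagma.of c) 1 := by
  simp [FreeNonUnitalNonAssocAlgebra.of, MonoidAlgebra.single_mul_single]

theorem of_mul_of_mul_of' (a b c : Fin 3) :
    FreeNonUnitalNonAssocAlgebra.of k a * (FreeNonUnitalNonAssocAlgebra.of k b *
        FreeNonUnitalNonAssocAlgebra.of k c) =
      MonoidAlgebra.single (FreeMagma.of a * (FreeMagma.of b * FreeMagma.of c)) 1 := by
  simp [FreeNonUnitalNonAssocAlgebra.of, MonoidAlgebra.single_mul_single]

@[simp]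
theorem FreeMagma.mul_mul_inj_left {X : Type} {a b c a' b' c' : X} :
    FreeMagma.of a * FreeMagma.of b * FreeMagma.of c =
      FreeMagma.of a' * FreeMagma.of b' * FreeMagma.of c' ↔ a = a' ∧ b = b' ∧ c = c' := by
  refine ⟨fun h => ?_, fun ⟨h, h', h''⟩ => by rw [h, h', h'']⟩
  injection h with h h3
  injection h with h1 h2
  injection h1 with h1
  injection h2 with h2
  injection h3 with h3
  exact ⟨h1, h2, h3⟩

@[simp]
theorem FreeMagma.mul_mul_inj_right {X : Type} {a b c a' b' c' : X} :
    FreeMagma.of a * (FreeMagma.of b * FreeMagma.of c) =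
      FreeMagma.of a' * (FreeMagma.of b' * FreeMagma.of c') ↔ a = a' ∧ b = b' ∧ c = c' := by
  refine ⟨fun h => ?_, fun ⟨h, h', h''⟩ => by rw [h, h', h'']⟩
  injection h with h1 h
  injection h with h2 h3
  injection h1 with h1
  injection h2 with h2
  injection h3 with h3
  exact ⟨h1, h2, h3⟩

@[simp]
theorem FreeMagma.mul_mul_ne {X : Type} {a b c a' b' c' : X} :
    FreeMagma.of a * FreeMagma.of b * FreeMagma.of c ≠
      FreeMagma.of a' * (FreeMagma.of b' * FreeMagma.of c') := by
  intro h
  injection h with h1 h2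
  injection h2

@[simp]
theorem FreeMagma.mul_mul_ne' {X : Type} {a b c a' b' c' : X} :
    FreeMagma.of a' * (FreeMagma.of b' * FreeMagma.of c') ≠
      FreeMagma.of a * FreeMagma.of b * FreeMagma.of c :=
  FreeMagma.mul_mul_ne.symm

theorem magmaCoeff_single (m m' : FreeMagma (Fin 3)) (c : k) :
    magmaCoeff m (MonoidAlgebra.single m' c) = if m' = m then c else 0 :=
  Finsupp.single_apply

theorem lift_associatorIdentity (e : k) (σ : Equiv.Perm (Fin 3)) :
    FreeNonUnitalNonAssocAlgebra.lift k
        (fun i => FreeNonUnitalNonAssocAlgebra.of k (σ i)) (associatorIdentity e) =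
      associator (FreeNonUnitalNonAssocAlgebra.of k (σ 0)) (FreeNonUnitalNonAssocAlgebra.of k (σ 1))
        (FreeNonUnitalNonAssocAlgebra.of k (σ 2)) -
      e • associator (FreeNonUnitalNonAssocAlgebra.of k (σ 2))
        (FreeNonUnitalNonAssocAlgebra.of k (σ 1)) (FreeNonUnitalNonAssocAlgebra.of k (σ 0)) := by
  simp only [associatorIdentity, associator, map_sub, map_smul, map_mul,
    FreeNonUnitalNonAssocAlgebra.lift_of_apply]

/-- In every relation, the coefficients of `(ab)c` and `a(bc)` are opposite. -/
theorem magmaCoeff_add_eq_zero (e : k) (a b c : Fin 3)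
    {g : FreeNonUnitalNonAssocAlgebra k (Fin 3)} (hg : g ∈ symmetricRelations (associatorIdentity e)) :
    magmaCoeff (FreeMagma.of a * FreeMagma.of b * FreeMagma.of c) g +
      magmaCoeff (FreeMagma.of a * (FreeMagma.of b * FreeMagma.of c)) g = 0 := by
  induction hg using Submodule.span_induction with
  | zero => simp
  | add x y _ _ hx hy => rw [map_add, map_add]; linear_combination hx + hy
  | smul r x _ hx => rw [map_smul, map_smul, ← smul_add, hx, smul_zero]
  | mem x hx =>
    obtain ⟨σ, rfl⟩ := hx
    beta_reduce
    rw [lift_associatorIdentity]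
    simp only [associator, of_mul_of_mul_of, of_mul_of_mul_of', map_sub, map_smul, magmaCoeff_single]
    simp

/-- In every relation, the coefficient of `(ab)c` is `-e` times that of `(cb)a`. -/
theorem magmaCoeff_add_mul_eq_zero (e : k) (he : e * e = 1) (a b c : Fin 3)
    {g : FreeNonUnitalNonAssocAlgebra k (Fin 3)} (hg : g ∈ symmetricRelations (associatorIdentity e)) :
    magmaCoeff (FreeMagma.of a * FreeMagma.of b * FreeMagma.of c) g +
      e * magmaCoeff (FreeMagma.of c * FreeMagma.of b * FreeMagma.of a) g = 0 := by
  induction hg using Submodule.span_induction with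
  | zero => simp
  | add x y _ _ hx hy => rw [map_add, map_add]; linear_combination hx + hy
  | smul r x _ hx =>
    rw [map_smul, map_smul, smul_eq_mul, smul_eq_mul]
    linear_combination r * hx
  | mem x hx =>
    obtain ⟨σ, rfl⟩ := hx
    beta_reduce
    rw [lift_associatorIdentity]
    simp only [associator, of_mul_of_mul_of, of_mul_of_mul_of', map_sub, map_smul, magmaCoeff_single]
    simp only [FreeMagma.mul_mul_inj_left, FreeMagma.mul_mul_ne', if_false, smul_eq_mul]
    have h1 : (σ 2 = c ∧ σ 1 = b ∧ σ 0 = a) ↔ (σ 0 = a ∧ σ 1 = b ∧ σ 2 = c) := by tauto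
    have h2 : (σ 2 = a ∧ σ 1 = b ∧ σ 0 = c) ↔ (σ 0 = c ∧ σ 1 = b ∧ σ 2 = a) := by tauto
    simp only [h1, h2]
    split_ifs <;> first | ring1 | linear_combination -he

/-- The nonassociative component of the natural projection. -/
noncomputable def varProjection :
    FreeNS k ManinOp 3 →ₗ[k] FreeNonUnitalNonAssocAlgebra k (Fin 3) :=
  Finsupp.linearCombination k fun t =>
    t.1.eval varOp fun i => FreeNonUnitalNonAssocAlgebra.of k (Fin.cast t.2 i)

theorem eval_asOp (t : TreeMonomial ManinOp 3) :
    t.1.eval asOp (fun i => FreeAlgebra.ι k (Fin.cast t.2 i)) =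
      FreeAlgebra.ι k 0 * FreeAlgebra.ι k 1 * FreeAlgebra.ι k 2 := by
  rcases t.eq_leftComb_or_rightComb with ⟨o, o', rfl⟩ | ⟨o, o', rfl⟩
  · rfl
  · exact (mul_assoc _ _ _).symm

theorem maninProjection_apply (f : FreeNonUnitalNonAssocAlgebra k (Fin 3)) (g : FreeNS k ManinOp 3) :
    maninProjection f g = (FreeAlgebra.ι k 0 * FreeAlgebra.ι k 1 * FreeAlgebra.ι k 2) ⊗ₜ[k]
      (symmetricRelations f).mkQ (varProjection g) := by
  simp only [maninProjection, eval_asOp, varProjection, Finsupp.linearCombination_apply,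
    Finsupp.sum, map_sum, map_smul, TensorProduct.tmul_sum, TensorProduct.tmul_smul]

/-- By associativity the first tensor factor is always `x₀x₁x₂`, and tensoring with this fixed
nonzero vector loses no information. -/
theorem mem_ker_maninProjection {f : FreeNonUnitalNonAssocAlgebra k (Fin 3)}
    {g : FreeNS k ManinOp 3} :
    g ∈ LinearMap.ker (maninProjection f) ↔ varProjection g ∈ symmetricRelations f := by
  rw [LinearMap.mem_ker, maninProjection_apply, ← Submodule.Quotient.mk_eq_zero,
    ← Submodule.mkQ_apply]
  refine ⟨fun h => ?_, fun h => by rw [h, TensorProduct.tmul_zero]⟩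
  -- The character sending every generator to `1` takes `x₀x₁x₂` to `1`, so it recovers the second
  -- factor.
  have := congrArg (TensorProduct.lid k _ ∘ LinearMap.rTensor _
    (FreeAlgebra.lift k (fun _ : Fin 3 => (1 : k))).toLinearMap) h
  simpa using this

theorem varProjection_leftComb (o o' : ManinOp) (c : k) :
    varProjection (treeSingle (leftComb o o') c) =
      c • varOp o (varOp o' (FreeNonUnitalNonAssocAlgebra.of k 0)
        (FreeNonUnitalNonAssocAlgebra.of k 1)) (FreeNonUnitalNonAssocAlgebra.of k 2) :=
  Finsupp.linearCombination_single _ _ _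

theorem varProjection_rightComb (o o' : ManinOp) (c : k) :
    varProjection (treeSingle (rightComb o o') c) =
      c • varOp o (FreeNonUnitalNonAssocAlgebra.of k 0)
        (varOp o' (FreeNonUnitalNonAssocAlgebra.of k 1) (FreeNonUnitalNonAssocAlgebra.of k 2)) :=
  Finsupp.linearCombination_single _ _ _

theorem varProjection_maninRelation (e : k) (he : e * e = 1) :
    varProjection (maninRelation (-e)) = e • associatorIdentity e := by
  rw [maninRelation, map_sub, map_sub, map_smul, map_sub]
  simp only [varProjection_leftComb, varProjection_rightComb,
    varOp, associatorIdentity, associator, smul_sub, smul_smul, one_smul, he, neg_smul]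
  abel

/-- The eight trees map to eight distinct nonassociative monomials. The mixed ones have no partner
with the other bracketing in the image, so their coefficients vanish; the remaining four
coefficients are tied together by three equations. -/
theorem ker_maninProjection_associatorIdentity (e : k) (he : e * e = 1) :
    LinearMap.ker (maninProjection (associatorIdentity e)) =
      Submodule.span k {maninRelation (-e)} := by
  apply le_antisymm
  · intro g hg
    rw [mem_ker_maninProjection] at hg
    set h := varProjection g with hh
    have h1 := magmaCoeff_add_eq_zero e 0 1 2 hg
    have h2 := magmaCoeff_add_eq_zero e 1 0 2 hg
    have h3 := magmaCoeff_add_eq_zero e 2 0 1 hg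
    have h4 := magmaCoeff_add_eq_zero e 2 1 0 hg
    have h5 := magmaCoeff_add_eq_zero e 0 2 1 hg
    have h6 := magmaCoeff_add_eq_zero e 1 2 0 hg
    have h7 := magmaCoeff_add_mul_eq_zero e he 0 1 2 hg
    rw [hh, FreeNS.eq_sum_combs g] at h1 h2 h3 h4 h5 h6 h7
    simp only [map_add, varProjection_leftComb, varProjection_rightComb, varOp, of_mul_of_mul_of,
      of_mul_of_mul_of', map_smul, magmaCoeff_single] at h1 h2 h3 h4 h5 h6 h7
    simp at h1 h2 h3 h4 h5 h6 h7
    rw [Submodule.mem_span_singleton]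
    refine ⟨g (leftComb ManinOp.succ ManinOp.succ), Finsupp.ext fun t => ?_⟩
    simp only [maninRelation, Finsupp.smul_apply, Finsupp.sub_apply, smul_eq_mul, neg_mul]
    rcases t.eq_leftComb_or_rightComb with ⟨o, o', rfl⟩ | ⟨o, o', rfl⟩ <;> cases o <;> cases o' <;>
      simp [h2, h3, h5, h6]
    · linear_combination e * h4 - h7
    · linear_combination h7 - h1 - e * h4
    · linear_combination -h4
  · rw [Submodule.span_singleton_le_iff_mem, mem_ker_maninProjection,
      varProjection_maninRelation e he]
    refine Submodule.smul_mem _ _ (Submodule.subset_span ⟨1, ?_⟩)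
    beta_reduce
    rw [lift_associatorIdentity]
    rfl

end Relations

/-! ### Trees of all arities -/

section Trees

variable {k : Type*} [Field k] {I : Type}

/-- The bilinear extension of `PlanarTree.node o`. -/
noncomputable def nodeLin (o : I) :
    (PlanarTree I →₀ k) →ₗ[k] (PlanarTree I →₀ k) →ₗ[k] (PlanarTree I →₀ k) :=
  Finsupp.linearCombination k fun t => Finsupp.lmapDomain k k (PlanarTree.node o t)

@[simp]
theorem nodeLin_single (o : I) (t s : PlanarTree I) (a b : k) :
    nodeLin o (Finsupp.single t a) (Finsupp.single s b) =
      Finsupp.single (PlanarTree.node o t s) (a * b) := by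
  simp [nodeLin, Finsupp.mapDomain_single]

/-- The bilinear extension of `PlanarTree.graft · i ·`. -/
noncomputable def graftLin (i : ℕ) :
    (PlanarTree I →₀ k) →ₗ[k] (PlanarTree I →₀ k) →ₗ[k] (PlanarTree I →₀ k) :=
  Finsupp.linearCombination k fun t => Finsupp.lmapDomain k k (PlanarTree.graft t i)

@[simp]
theorem graftLin_single (i : ℕ) (t s : PlanarTree I) (a b : k) :
    graftLin i (Finsupp.single t a) (Finsupp.single s b) =
      Finsupp.single (t.graft i s) (a * b) := by
  simp [graftLin, Finsupp.mapDomain_single]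

@[simp]
theorem FreeNS.comp_single {m n : ℕ} (i : Fin m) (t : TreeMonomial I m) (s : TreeMonomial I n)
    (a b : k) :
    FreeNS.comp i (Finsupp.single t a) (Finsupp.single s b) =
      Finsupp.single (TreeMonomial.comp i t s) (a * b) := by
  simp [FreeNS.comp, Finsupp.mapDomain_single]

/-- The inclusion of a component of the free operad into the space spanned by all trees. -/
noncomputable def FreeNS.toTrees (n : ℕ) : FreeNS k I n →ₗ[k] (PlanarTree I →₀ k) :=
  Finsupp.lmapDomain k k Subtype.val

@[simp]
theorem FreeNS.toTrees_single {n : ℕ} (t : TreeMonomial I n) (a : k) :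
    FreeNS.toTrees n (Finsupp.single t a) = Finsupp.single t.1 a := by
  simp [FreeNS.toTrees, Finsupp.mapDomain_single]

theorem FreeNS.toTrees_comp {m n : ℕ} (i : Fin m) (f : FreeNS k I m) (g : FreeNS k I n) :
    FreeNS.toTrees _ (FreeNS.comp i f g) =
      graftLin i (FreeNS.toTrees m f) (FreeNS.toTrees n g) := by
  induction f using Finsupp.induction_linear with
  | zero => simp
  | add f f' hf hf' => simp [hf, hf']
  | single t a =>
    induction g using Finsupp.induction_linear with
    | zero => simp
    | add g g' hg hg' => simp [hg, hg']
    | single s b => simp [TreeMonomial.comp, -Finsupp.single_mul]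

/-- The projection onto the component of arity `n`. -/
noncomputable def FreeNS.ofTrees (n : ℕ) : (PlanarTree I →₀ k) →ₗ[k] FreeNS k I n :=
  Finsupp.lsubtypeDomain {t : PlanarTree I | t.arity = n}

theorem FreeNS.ofTrees_toTrees (n : ℕ) (f : FreeNS k I n) :
    FreeNS.ofTrees n (FreeNS.toTrees n f) = f := by
  ext t
  exact Finsupp.mapDomain_apply Subtype.val_injective f t

theorem FreeNS.ofTrees_toTrees_of_ne {m n : ℕ} (h : m ≠ n) (f : FreeNS k I m) :
    FreeNS.ofTrees n (FreeNS.toTrees m f) = 0 := by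
  ext t
  refine Finsupp.mapDomain_of_notMem_range f t.1 ?_
  rintro ⟨s, hs⟩
  exact h (by rw [← s.2, hs, t.2])

/-! ### Operadic ideals as subspaces of the span of all trees -/

theorem isOperadicIdeal_quadraticIdeal (R : Submodule k (FreeNS k I 3)) :
    IsOperadicIdeal (quadraticIdeal R) where
  comp_left i f g hf := by
    simp only [quadraticIdeal, Submodule.mem_iInf] at hf ⊢
    exact fun J hJ hR => hJ.comp_left i f g (hf J hJ hR)
  comp_right i f g hg := by
    simp only [quadraticIdeal, Submodule.mem_iInf] at hg ⊢
    exact fun J hJ hR => hJ.comp_right i f g (hg J hJ hR)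

theorem le_quadraticIdeal (R : Submodule k (FreeNS k I 3)) : R ≤ quadraticIdeal R 3 := by
  intro f hf
  simp only [quadraticIdeal, Submodule.mem_iInf]
  exact fun J _ hR => hR hf

theorem quadraticIdeal_le {R : Submodule k (FreeNS k I 3)}
    {J : (n : ℕ) → Submodule k (FreeNS k I n)} (hJ : IsOperadicIdeal J) (hR : R ≤ J 3) (n : ℕ) :
    quadraticIdeal R n ≤ J n :=
  iInf_le_of_le J (iInf_le_of_le hJ (iInf_le _ hR))

/-- The sum of the components of a family of subspaces of the free operad. -/
noncomputable def totalSubmodule (J : (n : ℕ) → Submodule k (FreeNS k I n)) :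
    Submodule k (PlanarTree I →₀ k) :=
  ⨆ n, (J n).map (FreeNS.toTrees n)

variable {J : (n : ℕ) → Submodule k (FreeNS k I n)}

theorem toTrees_mem_totalSubmodule {n : ℕ} {f : FreeNS k I n} (hf : f ∈ J n) :
    FreeNS.toTrees n f ∈ totalSubmodule J :=
  Submodule.mem_iSup_of_mem n (Submodule.mem_map_of_mem hf)

theorem totalSubmodule_le {N : Submodule k (PlanarTree I →₀ k)}
    (h : ∀ n, ∀ f ∈ J n, FreeNS.toTrees n f ∈ N) : totalSubmodule J ≤ N :=
  iSup_le fun n => Submodule.map_le_iff_le_comap.2 (h n)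

/-- The sum over arities is graded: projecting to arity `n` kills all other summands. Membership can
thus be tested among all trees, without casts between arities. -/
theorem mem_of_toTrees_mem_totalSubmodule {n : ℕ} {f : FreeNS k I n}
    (hf : FreeNS.toTrees n f ∈ totalSubmodule J) : f ∈ J n := by
  have key : totalSubmodule J ≤ (J n).comap (FreeNS.ofTrees n) := by
    refine totalSubmodule_le fun m g hg => ?_
    rw [Submodule.mem_comap]
    by_cases hmn : m = n
    · subst hmn
      rwa [FreeNS.ofTrees_toTrees]
    · rw [FreeNS.ofTrees_toTrees_of_ne hmn]
      exact zero_mem _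
  simpa only [Submodule.mem_comap, FreeNS.ofTrees_toTrees] using key hf

/-- The tree with one internal vertex. -/
def corolla (o : I) : TreeMonomial I 2 :=
  ⟨.node o .leaf .leaf, rfl⟩

/-- The right leaf is filled first, so that the index of the left leaf is not shifted. -/
theorem nodeLin_eq_graftLin (o : I) (f g : PlanarTree I →₀ k) :
    nodeLin o f g = graftLin 0 (graftLin 1 (Finsupp.single (corolla o).1 1) g) f := by
  induction f using Finsupp.induction_linear with
  | zero => simp
  | add f f' hf hf' => simp [hf, hf']
  | single t a =>
    induction g using Finsupp.induction_linear with
    | zero => simp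
    | add g g' hg hg' => simp only [map_add, LinearMap.add_apply, hg, hg']
    | single s b => simp [corolla, PlanarTree.graft, PlanarTree.arity, mul_comm]

theorem IsOperadicIdeal.nodeLin_left_mem (hJ : IsOperadicIdeal J) (o : I)
    {f : PlanarTree I →₀ k} (hf : f ∈ totalSubmodule J) (g : PlanarTree I →₀ k) :
    nodeLin o f g ∈ totalSubmodule J := by
  suffices h : totalSubmodule J ≤ (totalSubmodule J).comap ((nodeLin o).flip g) from h hf
  refine totalSubmodule_le fun m f hf => ?_
  rw [Submodule.mem_comap, LinearMap.flip_apply]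
  induction g using Finsupp.induction_linear with
  | zero => simp
  | add g g' hg hg' => rw [map_add]; exact add_mem hg hg'
  | single s b =>
    have h : FreeNS.toTrees _ (FreeNS.comp ⟨0, by have := s.arity_pos; omega⟩ (FreeNS.comp (1 : Fin 2)
        (Finsupp.single (corolla o) 1) (Finsupp.single (⟨s, rfl⟩ : TreeMonomial I s.arity) b)) f) =
        nodeLin o (FreeNS.toTrees m f) (Finsupp.single s b) := by
      rw [FreeNS.toTrees_comp, FreeNS.toTrees_comp, nodeLin_eq_graftLin]
      simp
    rw [← h]
    exact toTrees_mem_totalSubmodule (hJ.comp_right _ _ _ hf)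

theorem IsOperadicIdeal.nodeLin_right_mem (hJ : IsOperadicIdeal J) (o : I)
    (f : PlanarTree I →₀ k) {g : PlanarTree I →₀ k} (hg : g ∈ totalSubmodule J) :
    nodeLin o f g ∈ totalSubmodule J := by
  suffices h : totalSubmodule J ≤ (totalSubmodule J).comap (nodeLin o f) from h hg
  refine totalSubmodule_le fun m g hg => ?_
  rw [Submodule.mem_comap]
  induction f using Finsupp.induction_linear with
  | zero => simp
  | add f f' hf hf' => rw [map_add, LinearMap.add_apply]; exact add_mem hf hf'
  | single s b =>
    have h : FreeNS.toTrees _ (FreeNS.comp ⟨0, by omega⟩ (FreeNS.comp (1 : Fin 2)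
        (Finsupp.single (corolla o) 1) g) (Finsupp.single (⟨s, rfl⟩ : TreeMonomial I s.arity) b)) =
        nodeLin o (Finsupp.single s b) (FreeNS.toTrees m g) := by
      rw [FreeNS.toTrees_comp, FreeNS.toTrees_comp, nodeLin_eq_graftLin]
      simp
    rw [← h]
    exact toTrees_mem_totalSubmodule (hJ.comp_left _ _ _ (hJ.comp_right _ _ _ hg))

/-- Inserting arbitrary elements into the leaves of an arity `3` element of an operadic ideal. -/
theorem IsOperadicIdeal.graftLin_mem (hJ : IsOperadicIdeal J) {r : FreeNS k I 3} (hr : r ∈ J 3)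
    (a b c : PlanarTree I →₀ k) :
    graftLin 0 (graftLin 1 (graftLin 2 (FreeNS.toTrees 3 r) c) b) a ∈ totalSubmodule J := by
  induction a using Finsupp.induction_linear with
  | zero => simp
  | add x y hx hy => rw [map_add]; exact add_mem hx hy
  | single a a' =>
  induction b using Finsupp.induction_linear with
  | zero => simp
  | add x y hx hy => simp only [map_add, LinearMap.add_apply]; exact add_mem hx hy
  | single b b' =>
  induction c using Finsupp.induction_linear with
  | zero => simp
  | add x y hx hy => simp only [map_add, LinearMap.add_apply]; exact add_mem hx hy
  | single c c' =>
    -- Filling the leaves from right to left keeps the indices `2`, `1`, `0` valid throughout.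
    have h : FreeNS.toTrees _ (FreeNS.comp ⟨0, by have := b.arity_pos; omega⟩ (FreeNS.comp ⟨1, by omega⟩
        (FreeNS.comp (2 : Fin 3) r (Finsupp.single (⟨c, rfl⟩ : TreeMonomial I c.arity) c'))
        (Finsupp.single (⟨b, rfl⟩ : TreeMonomial I b.arity) b'))
        (Finsupp.single (⟨a, rfl⟩ : TreeMonomial I a.arity) a')) =
        graftLin 0 (graftLin 1 (graftLin 2 (FreeNS.toTrees 3 r) (Finsupp.single c c'))
          (Finsupp.single b b')) (Finsupp.single a a') := by
      rw [FreeNS.toTrees_comp, FreeNS.toTrees_comp, FreeNS.toTrees_comp]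
      simp
    rw [← h]
    exact toTrees_mem_totalSubmodule (hJ.comp_left _ _ _ (hJ.comp_left _ _ _
      (hJ.comp_left _ _ _ hr)))

/-- Inserting elements into the relation `maninRelation ε`. -/
theorem graftLin_maninRelation (ε : k) (a b c : PlanarTree ManinOp →₀ k) :
    graftLin 0 (graftLin 1 (graftLin 2 (FreeNS.toTrees 3 (maninRelation ε)) c) b) a =
      nodeLin ManinOp.succ (nodeLin ManinOp.succ a b) c -
        nodeLin ManinOp.succ a (nodeLin ManinOp.succ b c) -
      ε • (nodeLin ManinOp.prec (nodeLin ManinOp.prec a b) c -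
        nodeLin ManinOp.prec a (nodeLin ManinOp.prec b c)) := by
  induction a using Finsupp.induction_linear with
  | zero => simp
  | add x y hx hy => simp only [map_add, LinearMap.add_apply, hx, hy, smul_sub, smul_add]; abel
  | single a a' =>
  induction b using Finsupp.induction_linear with
  | zero => simp
  | add x y hx hy => simp only [map_add, LinearMap.add_apply, hx, hy, smul_sub, smul_add]; abel
  | single b b' =>
  induction c using Finsupp.induction_linear with
  | zero => simp
  | add x y hx hy => simp only [map_add, LinearMap.add_apply, hx, hy, smul_sub, smul_add]; abel
  | single c c' =>
    have e : c' * b' * a' = a' * b' * c' := by ring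
    simp [maninRelation, leftComb, rightComb, PlanarTree.graft, PlanarTree.arity, e, mul_assoc,
      -Finsupp.single_mul]

end Trees

/-! ### Evaluation of trees in algebras with several bilinear operations -/

section Evaluation

variable {k : Type*} [Field k] {I : Type} {A : Type*} [AddCommGroup A] [Module k A]

/-- The value of a tree, when its leaves are replaced by the first entries of the sequence `v`. -/
def PlanarTree.evalSeq (μ : I → A →ₗ[k] A →ₗ[k] A) : PlanarTree I → (ℕ → A) → A
  | leaf, v => v 0
  | node o l r, v => μ o (l.evalSeq μ v) (r.evalSeq μ fun j => v (j + l.arity))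

variable (μ : I → A →ₗ[k] A →ₗ[k] A)

theorem PlanarTree.evalSeq_congr (t : PlanarTree I) {v w : ℕ → A} (h : ∀ j < t.arity, v j = w j) :
    t.evalSeq μ v = t.evalSeq μ w := by
  induction t generalizing v w with
  | leaf => exact h 0 Nat.one_pos
  | node o l r hl hr =>
    simp only [arity] at h
    simp only [evalSeq]
    rw [hl fun j hj => h j (by omega), hr fun j hj => h _ (by omega)]

/-- Leaf `i` receives the value of `s`; the leaves after it skip the `s.arity` inputs used by `s`,
one of which replaces leaf `i` itself, hence the shift by `s.arity - 1`. -/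
theorem PlanarTree.evalSeq_graft (t s : PlanarTree I) {i : ℕ} (hi : i < t.arity) (v : ℕ → A) :
    (t.graft i s).evalSeq μ v =
      t.evalSeq μ (Function.update (fun j => if j < i then v j else v (j + s.arity - 1)) i
        (s.evalSeq μ fun j => v (j + i))) := by
  induction t generalizing i v with
  | leaf =>
    obtain rfl : i = 0 := by simpa [arity] using hi
    simp [graft, evalSeq]
  | node o l r hl hr =>
    simp only [arity] at hi
    have hs := s.arity_pos
    simp only [graft]
    split_ifs with h
    · simp only [evalSeq]
      rw [hl h, arity_graft _ _ _ h]
      congr 1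
      refine evalSeq_congr μ _ fun j _ => ?_
      rw [Function.update_of_ne (by omega), if_neg (by omega)]
      congr 1
      omega
    · simp only [evalSeq]
      rw [hr (i := i - l.arity) (by omega)]
      congr 2
      · refine evalSeq_congr μ _ fun j hj => ?_
        rw [Function.update_of_ne (by omega), if_pos (by omega)]
      · ext j
        rcases eq_or_ne j (i - l.arity) with rfl | hj
        · rw [Function.update_self, show i - l.arity + l.arity = i by omega, Function.update_self]
          congr 1
          ext j
          congr 1
          omega
        · rw [Function.update_of_ne hj, Function.update_of_ne (by omega)]
          by_cases h' : j < i - l.arity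
          · rw [if_pos h', if_pos (by omega)]
          · rw [if_neg h', if_neg (by omega)]
            congr 1
            omega

/-- Multilinearity of evaluation, in the form needed to substitute a linear combination for one
leaf. -/
theorem PlanarTree.exists_linearMap_evalSeq_update (t : PlanarTree I) {i : ℕ} (hi : i < t.arity)
    (w : ℕ → A) :
    ∃ φ : A →ₗ[k] A, ∀ x, t.evalSeq μ (Function.update w i x) = φ x := by
  induction t generalizing i w with
  | leaf =>
    obtain rfl : i = 0 := by simpa [arity] using hi
    exact ⟨LinearMap.id, fun x => by simp [evalSeq]⟩
  | node o l r hl hr =>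
    simp only [arity] at hi
    by_cases h : i < l.arity
    · obtain ⟨φ, hφ⟩ := hl h w
      refine ⟨(μ o).flip (r.evalSeq μ fun j => w (j + l.arity)) ∘ₗ φ, fun x => ?_⟩
      simp only [evalSeq, hφ, LinearMap.comp_apply, LinearMap.flip_apply]
      congr 1
      exact evalSeq_congr μ _ fun j _ => Function.update_of_ne (by omega) _ _
    · obtain ⟨φ, hφ⟩ := hr (i := i - l.arity) (by omega) fun j => w (j + l.arity)
      refine ⟨μ o (l.evalSeq μ w) ∘ₗ φ, fun x => ?_⟩
      simp only [evalSeq, ← hφ, LinearMap.comp_apply]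
      congr 2
      · exact evalSeq_congr μ _ fun j _ => Function.update_of_ne (by omega) _ _
      · ext j
        rcases eq_or_ne j (i - l.arity) with rfl | hj
        · rw [Function.update_self, show i - l.arity + l.arity = i by omega, Function.update_self]
        · rw [Function.update_of_ne hj, Function.update_of_ne (by omega)]

/-- Evaluation of linear combinations of trees. -/
noncomputable def evalLin (v : ℕ → A) : (PlanarTree I →₀ k) →ₗ[k] A :=
  Finsupp.linearCombination k fun t => t.evalSeq μ v

@[simp]
theorem evalLin_single (v : ℕ → A) (t : PlanarTree I) (c : k) :
    evalLin μ v (Finsupp.single t c) = c • t.evalSeq μ v :=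
  Finsupp.linearCombination_single _ _ _

/-- The elements of the free operad that vanish identically in an algebra. -/
noncomputable def evalIdeal (n : ℕ) : Submodule k (FreeNS k I n) :=
  ⨅ v : ℕ → A, LinearMap.ker (evalLin μ v ∘ₗ FreeNS.toTrees n)

theorem mem_evalIdeal {n : ℕ} {f : FreeNS k I n} :
    f ∈ evalIdeal μ n ↔ ∀ v, evalLin μ v (FreeNS.toTrees n f) = 0 := by
  simp [evalIdeal, Submodule.mem_iInf]

theorem evalLin_comp_single_right {m n : ℕ} (i : Fin m) (f : FreeNS k I m) (s : TreeMonomial I n)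
    (c : k) (v : ℕ → A) :
    evalLin μ v (FreeNS.toTrees _ (FreeNS.comp i f (Finsupp.single s c))) =
      c • evalLin μ (Function.update (fun j => if j < i then v j else v (j + n - 1)) i
        (s.1.evalSeq μ fun j => v (j + i))) (FreeNS.toTrees _ f) := by
  induction f using Finsupp.induction_linear with
  | zero => simp
  | add f g hf hg => simp only [map_add, LinearMap.add_apply, hf, hg, smul_add]
  | single t a =>
    simp only [FreeNS.comp_single, FreeNS.toTrees_single, evalLin_single, smul_smul]
    rw [mul_comm a c]
    congr 1
    have h := t.1.evalSeq_graft μ s.1 (i := i) (by rw [t.2]; exact i.2) v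
    rw [s.2] at h
    exact h

theorem evalLin_comp_single_left {m n : ℕ} (i : Fin m) (t : TreeMonomial I m) (a : k)
    (g : FreeNS k I n) (v : ℕ → A) :
    evalLin μ v (FreeNS.toTrees _ (FreeNS.comp i (Finsupp.single t a) g)) =
      a • t.1.evalSeq μ (Function.update (fun j => if j < i then v j else v (j + n - 1)) i
        (evalLin μ (fun j => v (j + i)) (FreeNS.toTrees _ g))) := by
  obtain ⟨φ, hφ⟩ := t.1.exists_linearMap_evalSeq_update μ (i := i) (by rw [t.2]; exact i.2)
    (fun j => if j < i then v j else v (j + n - 1))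
  rw [hφ]
  induction g using Finsupp.induction_linear with
  | zero => simp
  | add f g hf hg => simp only [map_add, hf, hg, smul_add]
  | single s c =>
    rw [evalLin_comp_single_right]
    simp only [FreeNS.toTrees_single, evalLin_single, φ.map_smul, ← hφ]
    rw [smul_comm]

/-- Vanishing is required for all inputs `v`: grafting into a leaf feeds an arbitrary element there,
so vanishing at one fixed input would not be stable under composition. -/
theorem isOperadicIdeal_evalIdeal : IsOperadicIdeal (evalIdeal μ) where
  comp_left i f g hf := by
    rw [mem_evalIdeal] at hf ⊢
    intro v
    induction g using Finsupp.induction_linear with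
    | zero => simp
    | add g g' hg hg' => simp only [map_add, hg, hg', add_zero]
    | single s c => rw [evalLin_comp_single_right, hf, smul_zero]
  comp_right {m n} i f g hg := by
    rw [mem_evalIdeal] at hg ⊢
    intro v
    induction f using Finsupp.induction_linear with
    | zero => simp
    | add f f' hf hf' => simp only [map_add, LinearMap.add_apply, hf, hf', add_zero]
    | single t a =>
      obtain ⟨φ, hφ⟩ := t.1.exists_linearMap_evalSeq_update μ (i := i) (by rw [t.2]; exact i.2)
        (fun j => if j < i then v j else v (j + n - 1))
      rw [evalLin_comp_single_left, hg, hφ, map_zero, smul_zero]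

theorem evalLin_maninRelation (μ : ManinOp → A →ₗ[k] A →ₗ[k] A) (ε : k) (v : ℕ → A) :
    evalLin μ v (FreeNS.toTrees 3 (maninRelation ε)) =
      μ ManinOp.succ (μ ManinOp.succ (v 0) (v 1)) (v 2) -
        μ ManinOp.succ (v 0) (μ ManinOp.succ (v 1) (v 2)) -
      ε • (μ ManinOp.prec (μ ManinOp.prec (v 0) (v 1)) (v 2) -
        μ ManinOp.prec (v 0) (μ ManinOp.prec (v 1) (v 2))) := by
  simp [maninRelation, leftComb, rightComb, PlanarTree.evalSeq, PlanarTree.arity]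

/-- For constant inputs the shift of the sequence in the right subtree is invisible, so evaluation
is a homomorphism from the free algebra on one generator. -/
theorem evalLin_const_nodeLin (o : I) (x : A) (f g : PlanarTree I →₀ k) :
    evalLin μ (fun _ => x) (nodeLin o f g) =
      μ o (evalLin μ (fun _ => x) f) (evalLin μ (fun _ => x) g) := by
  induction f using Finsupp.induction_linear with
  | zero => simp
  | add f f' hf hf' => simp [hf, hf']
  | single t a =>
    induction g using Finsupp.induction_linear with
    | zero => simp
    | add g g' hg hg' => simp only [map_add, hg, hg']
    | single s b => simp [PlanarTree.evalSeq, smul_smul, mul_comm, -Finsupp.single_mul]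

end Evaluation

/-! ### The quotient by an operadic ideal as an algebra on one generator -/

section Quotient

variable {k : Type*} [Field k] {I : Type} {J : (n : ℕ) → Submodule k (FreeNS k I n)}

/-- The operations on the quotient of the space of all trees by an operadic ideal. -/
noncomputable def IsOperadicIdeal.quotOp (hJ : IsOperadicIdeal J) (o : I) :
    ((PlanarTree I →₀ k) ⧸ totalSubmodule J) →ₗ[k] ((PlanarTree I →₀ k) ⧸ totalSubmodule J) →ₗ[k]
      ((PlanarTree I →₀ k) ⧸ totalSubmodule J) :=
  ((totalSubmodule J).liftQ
    ((totalSubmodule J).liftQ ((nodeLin o).compr₂ (totalSubmodule J).mkQ) fun f hf => by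
      rw [LinearMap.mem_ker]
      refine LinearMap.ext fun g => ?_
      exact (Submodule.Quotient.mk_eq_zero _).2 (hJ.nodeLin_left_mem o hf _)).flip fun g hg => by
      rw [LinearMap.mem_ker]
      refine LinearMap.ext fun f => ?_
      obtain ⟨f, rfl⟩ := Submodule.mkQ_surjective _ f
      exact (Submodule.Quotient.mk_eq_zero _).2 (hJ.nodeLin_right_mem o f hg)).flip

theorem IsOperadicIdeal.quotOp_mkQ (hJ : IsOperadicIdeal J) (o : I) (f g : PlanarTree I →₀ k) :
    hJ.quotOp o ((totalSubmodule J).mkQ f) ((totalSubmodule J).mkQ g) =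
      (totalSubmodule J).mkQ (nodeLin o f g) :=
  rfl

/-- This makes the quotient a universal test algebra: an element whose value at the generator is
zero lies in the ideal. -/
theorem IsOperadicIdeal.evalLin_quotOp (hJ : IsOperadicIdeal J) :
    evalLin hJ.quotOp (fun _ => (totalSubmodule J).mkQ (Finsupp.single PlanarTree.leaf 1)) =
      (totalSubmodule J).mkQ := by
  ext t
  simp only [LinearMap.comp_apply, Finsupp.lsingle_apply, evalLin_single, one_smul]
  induction t with
  | leaf => rfl
  | node o l r hl hr => rw [PlanarTree.evalSeq, hl, hr, hJ.quotOp_mkQ, nodeLin_single, one_mul]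

end Quotient

/-! ### A normal form when `ε` is a square -/

section NormalForm

variable {k : Type*} [Field k]

/-- Left multiplication by a tree for the operation `p` on the space of all trees that satisfies
`p (d a b) c = d a (d b c) + d a (p b c) + p a (d b c) - d (d a b) c - d (p a b) c`, where `d` is
`PlanarTree.node ManinOp.succ`. -/
noncomputable def shiftTree :
    PlanarTree ManinOp → (PlanarTree ManinOp →₀ k) →ₗ[k] (PlanarTree ManinOp →₀ k)
  | .leaf => nodeLin ManinOp.prec (Finsupp.single .leaf 1)
  | .node .prec l r => nodeLin ManinOp.prec (Finsupp.single (.node .prec l r) 1)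
  | .node .succ l r =>
      nodeLin ManinOp.succ (Finsupp.single l 1) ∘ₗ nodeLin ManinOp.succ (Finsupp.single r 1) +
        nodeLin ManinOp.succ (Finsupp.single l 1) ∘ₗ shiftTree r +
        shiftTree l ∘ₗ nodeLin ManinOp.succ (Finsupp.single r 1) -
        nodeLin ManinOp.succ (Finsupp.single (.node .succ l r) 1) -
        nodeLin ManinOp.succ (shiftTree l (Finsupp.single r 1))

/-- The bilinear extension of `shiftTree`. -/
noncomputable def shift : (PlanarTree ManinOp →₀ k) →ₗ[k] (PlanarTree ManinOp →₀ k) →ₗ[k]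
    (PlanarTree ManinOp →₀ k) :=
  Finsupp.linearCombination k shiftTree

@[simp]
theorem shift_single (t : PlanarTree ManinOp) (c : k) :
    shift (Finsupp.single t c) = c • shiftTree t :=
  Finsupp.linearCombination_single _ _ _

/-- The last clause of `shiftTree`, extended linearly; the rewriting rule thus holds for all
elements, normal or not. -/
theorem shift_nodeLin_succ (a b c : PlanarTree ManinOp →₀ k) :
    shift (nodeLin ManinOp.succ a b) c =
      nodeLin ManinOp.succ a (nodeLin ManinOp.succ b c) + nodeLin ManinOp.succ a (shift b c) +
        shift a (nodeLin ManinOp.succ b c) - nodeLin ManinOp.succ (nodeLin ManinOp.succ a b) c -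
        nodeLin ManinOp.succ (shift a b) c := by
  induction a using Finsupp.induction_linear with
  | zero => simp
  | add x y hx hy => simp only [map_add, LinearMap.add_apply, hx, hy]; abel
  | single a a' =>
  induction b using Finsupp.induction_linear with
  | zero => simp
  | add x y hx hy => simp only [map_add, LinearMap.add_apply, hx, hy]; abel
  | single b b' =>
    have ha : Finsupp.single a a' = a' • Finsupp.single a (1 : k) := by simp
    have hb : Finsupp.single b b' = b' • Finsupp.single b (1 : k) := by simp
    rw [ha, hb]
    simp only [map_smul, LinearMap.smul_apply, nodeLin_single, mul_one, shift_single, one_smul,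
      shiftTree, LinearMap.add_apply, LinearMap.sub_apply, LinearMap.comp_apply, smul_add, smul_sub,
      smul_comm b' a']

/-- The operations `≺` and `≻` on the space of all trees. -/
noncomputable def modelOp (i : k) : ManinOp → (PlanarTree ManinOp →₀ k) →ₗ[k]
    (PlanarTree ManinOp →₀ k) →ₗ[k] (PlanarTree ManinOp →₀ k)
  | .prec => i⁻¹ • shift
  | .succ => nodeLin ManinOp.succ + shift

/-- With `≻ = d + p` and `≺ = i⁻¹ p`, the terms containing `p` twice cancel because `i² i⁻² = 1`;
what remains is `shift_nodeLin_succ`. -/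
theorem maninRelation_mem_evalIdeal {i : k} (hi : i ≠ 0) :
    maninRelation (i * i) ∈ evalIdeal (modelOp i) 3 := by
  rw [mem_evalIdeal]
  intro v
  rw [evalLin_maninRelation]
  have h : i * i * (i⁻¹ * i⁻¹) = 1 := by field_simp
  simp only [modelOp, LinearMap.add_apply, LinearMap.smul_apply, map_add, map_smul, smul_sub,
    smul_smul, h, one_smul, shift_nodeLin_succ]
  abel

/-! ### Comparing the model with an arbitrary algebra satisfying the relation -/

section Universal

variable {Q : Type*} [AddCommGroup Q] [Module k Q] (μ : ManinOp → Q →ₗ[k] Q →ₗ[k] Q) (i : k)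

/-- The operations `≺` and `≻` after the change of generators `d = ≻ - i ≺`, `p = i ≺`. -/
noncomputable def changeOp : ManinOp → Q →ₗ[k] Q →ₗ[k] Q
  | .prec => i • μ ManinOp.prec
  | .succ => μ ManinOp.succ - i • μ ManinOp.prec

variable {μ i}

/-- Every clause of the recursion for `shiftTree` is forced in an algebra satisfying the relation,
by induction on the left argument with the right one arbitrary. -/
theorem evalLin_shift (h : ∀ a b c, μ ManinOp.succ (μ ManinOp.succ a b) c -
      μ ManinOp.succ a (μ ManinOp.succ b c) =
      (i * i) • (μ ManinOp.prec (μ ManinOp.prec a b) c - μ ManinOp.prec a (μ ManinOp.prec b c)))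
    (x : Q) (a b : PlanarTree ManinOp →₀ k) :
    evalLin (changeOp μ i) (fun _ => x) (shift a b) = changeOp μ i ManinOp.prec
      (evalLin (changeOp μ i) (fun _ => x) a) (evalLin (changeOp μ i) (fun _ => x) b) := by
  induction a using Finsupp.induction_linear with
  | zero => simp
  | add a a' ha ha' => simp only [map_add, LinearMap.add_apply, ha, ha']
  | single a c =>
    have hc : Finsupp.single a c = c • Finsupp.single a (1 : k) := by simp
    rw [hc]
    simp only [map_smul, LinearMap.smul_apply, shift_single, one_smul]
    congr 1
    clear hc
    induction a generalizing b with
    | leaf => rw [shiftTree, evalLin_const_nodeLin]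
    | node o l r hl hr =>
      cases o with
      | prec => rw [shiftTree, evalLin_const_nodeLin]
      | succ =>
        simp only [shiftTree, LinearMap.add_apply, LinearMap.sub_apply, LinearMap.comp_apply,
          map_add, map_sub, evalLin_const_nodeLin, hl, hr]
        have e : Finsupp.single (PlanarTree.node ManinOp.succ l r) (1 : k) =
            nodeLin ManinOp.succ (Finsupp.single l 1) (Finsupp.single r 1) := by simp
        rw [e, evalLin_const_nodeLin]
        generalize evalLin (changeOp μ i) (fun _ => x) (Finsupp.single l 1) = u
        generalize evalLin (changeOp μ i) (fun _ => x) (Finsupp.single r 1) = v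
        generalize evalLin (changeOp μ i) (fun _ => x) b = w
        have huvw := h u v w
        simp only [smul_sub, sub_eq_iff_eq_add] at huvw
        simp only [changeOp, LinearMap.sub_apply, LinearMap.smul_apply, map_sub, map_smul, smul_sub,
          smul_smul, huvw]
        abel

/-- `modelOp` and `changeOp` are mutually inverse changes of generators, so evaluation in any such
algebra factors through the model. -/
theorem evalLin_changeOp_evalSeq_modelOp (hi : i ≠ 0)
    (h : ∀ a b c, μ ManinOp.succ (μ ManinOp.succ a b) c -
      μ ManinOp.succ a (μ ManinOp.succ b c) =
      (i * i) • (μ ManinOp.prec (μ ManinOp.prec a b) c - μ ManinOp.prec a (μ ManinOp.prec b c)))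
    (x : Q) (t : PlanarTree ManinOp) :
    evalLin (changeOp μ i) (fun _ => x)
      (t.evalSeq (modelOp i) fun _ => Finsupp.single PlanarTree.leaf 1) =
      t.evalSeq μ fun _ => x := by
  induction t with
  | leaf => simp [PlanarTree.evalSeq]
  | node o l r hl hr =>
    cases o <;> simp [PlanarTree.evalSeq, modelOp, evalLin_shift h, evalLin_const_nodeLin, hl, hr,
      changeOp, smul_smul, hi]

theorem evalLin_changeOp_evalLin_modelOp (hi : i ≠ 0)
    (h : ∀ a b c, μ ManinOp.succ (μ ManinOp.succ a b) c -
      μ ManinOp.succ a (μ ManinOp.succ b c) =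
      (i * i) • (μ ManinOp.prec (μ ManinOp.prec a b) c - μ ManinOp.prec a (μ ManinOp.prec b c)))
    (x : Q) (f : PlanarTree ManinOp →₀ k) :
    evalLin (changeOp μ i) (fun _ => x)
      (evalLin (modelOp i) (fun _ => Finsupp.single PlanarTree.leaf 1) f) =
      evalLin μ (fun _ => x) f := by
  induction f using Finsupp.induction_linear with
  | zero => simp
  | add f g hf hg => simp only [map_add, hf, hg]
  | single t c => simp only [evalLin_single, map_smul, evalLin_changeOp_evalSeq_modelOp hi h]

end Universal

/-- Evaluation of the elements of arity `n` at the generator of the model. -/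
noncomputable def modelEval (i : k) (n : ℕ) :
    FreeNS k ManinOp n →ₗ[k] (PlanarTree ManinOp →₀ k) :=
  evalLin (modelOp i) (fun _ => Finsupp.single PlanarTree.leaf 1) ∘ₗ FreeNS.toTrees n

/-- The ideal dies in the model because the model satisfies the relation. Conversely, evaluation in
the quotient algebra, which is the projection modulo the ideal, factors through the model. -/
theorem ker_modelEval {i : k} (hi : i ≠ 0) (n : ℕ) :
    LinearMap.ker (modelEval i n) =
      quadraticIdeal (Submodule.span k {maninRelation (i * i)}) n := by
  apply le_antisymm
  · intro f hf
    have hJ := isOperadicIdeal_quadraticIdeal (Submodule.span k {maninRelation (i * i)})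
    apply mem_of_toTrees_mem_totalSubmodule
    rw [← Submodule.Quotient.mk_eq_zero, ← Submodule.mkQ_apply, ← hJ.evalLin_quotOp,
      ← evalLin_changeOp_evalLin_modelOp hi]
    · rw [LinearMap.mem_ker] at hf
      exact (congrArg _ hf).trans (map_zero _)
    · intro a b c
      obtain ⟨a, rfl⟩ := Submodule.mkQ_surjective _ a
      obtain ⟨b, rfl⟩ := Submodule.mkQ_surjective _ b
      obtain ⟨c, rfl⟩ := Submodule.mkQ_surjective _ c
      have h := hJ.graftLin_mem (le_quadraticIdeal _ (Submodule.mem_span_singleton_self _)) a b c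
      rw [graftLin_maninRelation, ← Submodule.Quotient.mk_eq_zero, ← Submodule.mkQ_apply,
        map_sub, map_sub, map_smul, map_sub, sub_eq_zero] at h
      simpa only [hJ.quotOp_mkQ] using h
  · refine (quadraticIdeal_le (isOperadicIdeal_evalIdeal (modelOp i)) ?_ n).trans
      (iInf_le _ fun _ => Finsupp.single PlanarTree.leaf 1)
    rw [Submodule.span_singleton_le_iff_mem]
    exact maninRelation_mem_evalIdeal hi

/-- The root of the tree is labelled by `≻`. -/
def PlanarTree.IsSuccRooted : PlanarTree ManinOp → Prop
  | node .succ _ _ => True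
  | _ => False

/-- No left child of a vertex labelled by `≺` is a vertex labelled by `≻`. -/
def PlanarTree.IsNormal : PlanarTree ManinOp → Prop
  | leaf => True
  | node .succ l r => l.IsNormal ∧ r.IsNormal
  | node .prec l r => (l.IsNormal ∧ ¬l.IsSuccRooted) ∧ r.IsNormal

/-- The span of the normal trees of arity `n`. -/
noncomputable def normalSubmodule (k : Type*) [Field k] (n : ℕ) :
    Submodule k (PlanarTree ManinOp →₀ k) :=
  Finsupp.supported k k {t | t.IsNormal ∧ t.arity = n}

theorem single_mem_normalSubmodule {t : PlanarTree ManinOp} (ht : t.IsNormal) (c : k) :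
    Finsupp.single t c ∈ normalSubmodule k t.arity :=
  Finsupp.single_mem_supported k c ⟨ht, rfl⟩

theorem normalSubmodule_le {n : ℕ} {N : Submodule k (PlanarTree ManinOp →₀ k)}
    (h : ∀ t : PlanarTree ManinOp, t.IsNormal → t.arity = n → Finsupp.single t 1 ∈ N) :
    normalSubmodule k n ≤ N := by
  rw [normalSubmodule, Finsupp.supported_eq_span_single, Submodule.span_le]
  rintro _ ⟨t, ht, rfl⟩
  exact h t ht.1 ht.2

theorem bilin_mem_normalSubmodule {μ : (PlanarTree ManinOp →₀ k) →ₗ[k]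
      (PlanarTree ManinOp →₀ k) →ₗ[k] (PlanarTree ManinOp →₀ k)} {m n : ℕ}
    (h : ∀ t : PlanarTree ManinOp, t.IsNormal → t.arity = m → ∀ b ∈ normalSubmodule k n,
      μ (Finsupp.single t 1) b ∈ normalSubmodule k (m + n))
    {a b : PlanarTree ManinOp →₀ k} (ha : a ∈ normalSubmodule k m) (hb : b ∈ normalSubmodule k n) :
    μ a b ∈ normalSubmodule k (m + n) := by
  suffices H : normalSubmodule k m ≤ (normalSubmodule k (m + n)).comap (μ.flip b) from H ha
  exact normalSubmodule_le fun t ht hm => h t ht hm b hb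

theorem nodeLin_succ_mem {m n : ℕ} {a b : PlanarTree ManinOp →₀ k}
    (ha : a ∈ normalSubmodule k m) (hb : b ∈ normalSubmodule k n) :
    nodeLin ManinOp.succ a b ∈ normalSubmodule k (m + n) := by
  refine bilin_mem_normalSubmodule (fun t ht hm b hb => ?_) ha hb
  suffices H : normalSubmodule k n ≤
    (normalSubmodule k (m + n)).comap (nodeLin ManinOp.succ (Finsupp.single t 1)) from H hb
  refine normalSubmodule_le fun s hs hn => ?_
  subst hm hn
  rw [Submodule.mem_comap, nodeLin_single]
  exact single_mem_normalSubmodule (t := .node .succ t s) ⟨ht, hs⟩ _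

theorem nodeLin_prec_mem {n : ℕ} {t : PlanarTree ManinOp} (ht : t.IsNormal)
    (ht' : ¬t.IsSuccRooted) {b : PlanarTree ManinOp →₀ k} (hb : b ∈ normalSubmodule k n) :
    nodeLin ManinOp.prec (Finsupp.single t 1) b ∈ normalSubmodule k (t.arity + n) := by
  suffices H : normalSubmodule k n ≤
    (normalSubmodule k (t.arity + n)).comap (nodeLin ManinOp.prec (Finsupp.single t 1)) from H hb
  refine normalSubmodule_le fun s hs hn => ?_
  subst hn
  rw [Submodule.mem_comap, nodeLin_single]
  exact single_mem_normalSubmodule (t := .node .prec t s) ⟨⟨ht, ht'⟩, hs⟩ _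

/-- Rewriting ends in normal trees: `≺` is placed only on top of a left factor not rooted at `≻`,
and the recursive calls have smaller left factors. -/
theorem shiftTree_mem {n : ℕ} {t : PlanarTree ManinOp} (ht : t.IsNormal)
    {b : PlanarTree ManinOp →₀ k} (hb : b ∈ normalSubmodule k n) :
    shiftTree t b ∈ normalSubmodule k (t.arity + n) := by
  induction t generalizing b n with
  | leaf => exact nodeLin_prec_mem ht id hb
  | node o l r hl hr =>
    cases o with
    | prec => exact nodeLin_prec_mem ht id hb
    | succ =>
      obtain ⟨hl', hr'⟩ := ht
      have h1 := single_mem_normalSubmodule hl' (1 : k)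
      have h2 := single_mem_normalSubmodule hr' (1 : k)
      have h3 := nodeLin_succ_mem h2 hb
      simp only [PlanarTree.arity, shiftTree]
      refine sub_mem (sub_mem (add_mem (add_mem ?_ ?_) ?_) ?_) ?_
      · rw [add_assoc]
        exact nodeLin_succ_mem h1 h3
      · rw [add_assoc]
        exact nodeLin_succ_mem h1 (hr hr' hb)
      · rw [add_assoc]
        exact hl hl' h3
      · exact nodeLin_succ_mem (single_mem_normalSubmodule (t := .node .succ l r) ⟨hl', hr'⟩ 1) hb
      · exact nodeLin_succ_mem (hl hl' h2) hb

theorem modelOp_mem (i : k) (o : ManinOp) {m n : ℕ} {a b : PlanarTree ManinOp →₀ k}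
    (ha : a ∈ normalSubmodule k m) (hb : b ∈ normalSubmodule k n) :
    modelOp i o a b ∈ normalSubmodule k (m + n) := by
  have h : shift a b ∈ normalSubmodule k (m + n) := by
    refine bilin_mem_normalSubmodule (fun t ht hm b hb => ?_) ha hb
    subst hm
    rw [shift_single, one_smul]
    exact shiftTree_mem ht hb
  cases o with
  | prec => exact Submodule.smul_mem _ _ h
  | succ => exact add_mem (nodeLin_succ_mem ha hb) h

theorem evalSeq_modelOp_mem (i : k) (t : PlanarTree ManinOp) :
    t.evalSeq (modelOp i) (fun _ => Finsupp.single PlanarTree.leaf 1) ∈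
      normalSubmodule k t.arity := by
  induction t with
  | leaf => exact single_mem_normalSubmodule (t := .leaf) trivial 1
  | node o l r hl hr => exact modelOp_mem i o hl hr

theorem FreeNS.exists_toTrees_eq_nodeLin {I : Type} (o : I) {m n : ℕ} (f : FreeNS k I m)
    (g : FreeNS k I n) : ∃ h : FreeNS k I (m + n),
      FreeNS.toTrees _ h = nodeLin o (FreeNS.toTrees _ f) (FreeNS.toTrees _ g) := by
  induction f using Finsupp.induction_linear with
  | zero => exact ⟨0, by simp⟩
  | add f f' hf hf' =>
    obtain ⟨h, hh⟩ := hf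
    obtain ⟨h', hh'⟩ := hf'
    exact ⟨h + h', by simp [hh, hh']⟩
  | single t a =>
    induction g using Finsupp.induction_linear with
    | zero => exact ⟨0, by simp⟩
    | add f f' hf hf' =>
      obtain ⟨h, hh⟩ := hf
      obtain ⟨h', hh'⟩ := hf'
      exact ⟨h + h', by simp only [map_add, hh, hh']⟩
    | single s b =>
      exact ⟨Finsupp.single ⟨.node o t.1 s.1, by simp [PlanarTree.arity, t.2, s.2]⟩ (a * b),
        by simp [-Finsupp.single_mul]⟩

theorem exists_modelEval_eq_modelOp {i : k} (o : ManinOp) {m n : ℕ}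
    {a b : PlanarTree ManinOp →₀ k} (ha : a ∈ LinearMap.range (modelEval i m))
    (hb : b ∈ LinearMap.range (modelEval i n)) :
    modelOp i o a b ∈ LinearMap.range (modelEval i (m + n)) := by
  obtain ⟨f, rfl⟩ := ha
  obtain ⟨g, rfl⟩ := hb
  obtain ⟨h, hh⟩ := FreeNS.exists_toTrees_eq_nodeLin o f g
  exact ⟨h, by rw [modelEval, LinearMap.comp_apply, hh, evalLin_const_nodeLin]; rfl⟩

theorem single_mem_range_modelEval {i : k} (hi : i ≠ 0) {t : PlanarTree ManinOp}
    (ht : t.IsNormal) :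
    Finsupp.single t 1 ∈ LinearMap.range (modelEval i t.arity) := by
  induction t with
  | leaf => exact ⟨Finsupp.single ⟨.leaf, rfl⟩ 1, by simp [modelEval, PlanarTree.evalSeq]⟩
  | node o l r hl hr =>
    have hp : ∀ a b : PlanarTree ManinOp →₀ k, shift a b = i • modelOp i ManinOp.prec a b := by
      intro a b
      simp [modelOp, smul_smul, hi]
    cases o with
    | prec =>
      have h : Finsupp.single (.node .prec l r) 1 =
          i • modelOp i ManinOp.prec (Finsupp.single l 1) (Finsupp.single r 1) := by
        -- Normality enters here: when the left subtree is not rooted at `≻`, `shiftTree` of it is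
        -- plain grafting.
        rw [← hp, shift_single, one_smul]
        obtain ⟨⟨-, h⟩, -⟩ := ht
        match l, h with
        | .leaf, _ => simp [shiftTree]
        | .node .prec _ _, _ => simp [shiftTree]
        | .node .succ _ _, h => exact absurd trivial h
      rw [h]
      exact Submodule.smul_mem _ _ (exists_modelEval_eq_modelOp _ (hl ht.1.1) (hr ht.2))
    | succ =>
      have h : Finsupp.single (.node .succ l r) 1 =
          modelOp i ManinOp.succ (Finsupp.single l 1) (Finsupp.single r 1) -
          i • modelOp i ManinOp.prec (Finsupp.single l 1) (Finsupp.single r 1) := by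
        rw [← hp]
        simp [modelOp]
      rw [h]
      exact sub_mem (exists_modelEval_eq_modelOp _ (hl ht.1) (hr ht.2))
        (Submodule.smul_mem _ _ (exists_modelEval_eq_modelOp _ (hl ht.1) (hr ht.2)))

theorem range_modelEval {i : k} (hi : i ≠ 0) (n : ℕ) :
    LinearMap.range (modelEval i n) = normalSubmodule k n := by
  apply le_antisymm
  · rintro _ ⟨f, rfl⟩
    induction f using Finsupp.induction_linear with
    | zero => simp
    | add f g hf hg => rw [map_add]; exact add_mem hf hg
    | single t c =>
      have h := evalSeq_modelOp_mem i t.1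
      rw [t.2] at h
      simpa [modelEval] using Submodule.smul_mem _ c h
  · refine normalSubmodule_le fun t ht hn => ?_
    subst hn
    exact single_mem_range_modelEval hi ht

/-- The number of normal trees of arity `n`. -/
noncomputable def normalCount (n : ℕ) : ℕ :=
  Nat.card {t : PlanarTree ManinOp // t.IsNormal ∧ t.arity = n}

theorem finrank_quadraticNS_of_square {i : k} (hi : i ≠ 0) (n : ℕ) :
    Module.finrank k (QuadraticNS (Submodule.span k {maninRelation (i * i)}) n) =
      normalCount n := by
  change Module.finrank k (FreeNS k ManinOp n ⧸ quadraticIdeal _ n) = _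
  rw [← ker_modelEval hi, (modelEval i n).quotKerEquivRange.finrank_eq,
    range_modelEval hi, normalSubmodule, (Finsupp.supportedEquivFinsupp _).finrank_eq, normalCount]
  -- `finrank` and `Nat.card` truncate the same cardinal, so finiteness plays no role.
  simp only [Module.finrank, rank_finsupp_self, Cardinal.toNat_lift]
  rfl

end NormalForm

/-! ### Extension of the base field -/

theorem PlanarTree.finite_arity_le {I : Type} [Finite I] (n : ℕ) :
    {t : PlanarTree I | t.arity ≤ n}.Finite := by
  induction n with
  | zero =>
    refine Set.finite_empty.subset fun t ht => ?_
    have := t.arity_pos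
    simp only [Set.mem_ofPred_eq] at ht
    omega
  | succ n ih =>
    refine ((Set.finite_singleton PlanarTree.leaf).union
      (Set.finite_iUnion fun o : I => ih.image2 (PlanarTree.node o) ih)).subset fun t ht => ?_
    cases t with
    | leaf => exact Or.inl rfl
    | node o l r =>
      have h1 := l.arity_pos
      have h2 := r.arity_pos
      simp only [Set.mem_ofPred_eq, arity] at ht
      exact Or.inr (Set.mem_iUnion.2 ⟨o, Set.mem_image2_of_mem (by simp only [Set.mem_ofPred_eq]; omega)
        (by simp only [Set.mem_ofPred_eq]; omega)⟩)

instance TreeMonomial.finite {I : Type} [Finite I] (n : ℕ) : Finite (TreeMonomial I n) :=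
  ((PlanarTree.finite_arity_le n).subset fun _ ht => le_of_eq ht).to_subtype

instance ManinOp.finite : Finite ManinOp :=
  Finite.of_surjective (fun b : Bool => cond b ManinOp.prec ManinOp.succ)
    fun | .prec => ⟨true, rfl⟩ | .succ => ⟨false, rfl⟩

section BaseChange

theorem Submodule.exists_fin_basis {k V : Type*} [Field k] [AddCommGroup V] [Module k V]
    [FiniteDimensional k V] (W : Submodule k V) :
    ∃ (d : ℕ) (b : Fin d → V), d = Module.finrank k W ∧ LinearIndependent k b ∧
      Submodule.span k (Set.range b) = W := by
  let b := Module.finBasis k W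
  refine ⟨_, W.subtype ∘ b, rfl, b.linearIndependent.map' W.subtype W.ker_subtype, ?_⟩
  rw [Set.range_comp, Submodule.span_image, b.span_eq, Submodule.map_top, Submodule.range_subtype]

/-- A `k`-basis of `W` stays linearly independent over `K` and spans the extension. -/
theorem finrank_span_mapRange_algebraMap {k : Type*} [Field k] (K : Type*) [Field K] [Algebra k K]
    {ι : Type*} [Finite ι] (W : Submodule k (ι →₀ k)) :
    Module.finrank K (Submodule.span K
      (Finsupp.mapRange.linearMap (α := ι) (Algebra.linearMap k K) '' (W : Set (ι →₀ k)))) =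
      Module.finrank k W := by
  obtain ⟨d, b, hd, hb, hW⟩ := W.exists_fin_basis
  have hv : LinearIndependent k fun j => ⇑(b j) :=
    hb.map' Finsupp.lcoeFun (LinearMap.ker_eq_bot.2 DFunLike.coe_injective)
  have hK : LinearIndependent K fun j =>
      Finsupp.mapRange.linearMap (Algebra.linearMap k K) (b j) :=
    LinearIndependent.of_comp Finsupp.lcoeFun
      ((linearIndependent_algebraMap_comp_iff (S := K)).2 hv)
  have hs : Submodule.span K
      (Finsupp.mapRange.linearMap (α := ι) (Algebra.linearMap k K) '' (W : Set (ι →₀ k))) =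
      Submodule.span K (Set.range fun j =>
        Finsupp.mapRange.linearMap (Algebra.linearMap k K) (b j)) := by
    apply le_antisymm
    · refine Submodule.span_le.2 (Set.image_subset_iff.2 fun f hf => ?_)
      rw [← hW] at hf
      rw [Set.mem_preimage]
      induction hf using Submodule.span_induction with
      | mem f hf =>
        obtain ⟨j, rfl⟩ := hf
        exact Submodule.subset_span ⟨j, rfl⟩
      | zero => rw [map_zero]; exact zero_mem _
      | add f g _ _ hf hg => rw [map_add]; exact add_mem hf hg
      | smul c f _ hf =>
        rw [map_smul, ← algebraMap_smul K]
        exact Submodule.smul_mem _ _ hf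
    · refine Submodule.span_mono ?_
      rintro _ ⟨j, rfl⟩
      refine ⟨b j, ?_, rfl⟩
      rw [← hW]
      exact Submodule.subset_span ⟨j, rfl⟩
  rw [hs, finrank_span_eq_card hK, Fintype.card_fin, hd]

variable {k : Type*} [Field k] (K : Type*) [Field K] [Algebra k K] {I : Type}

/-- Extension of scalars on the components of the free operad. -/
noncomputable def FreeNS.extend (n : ℕ) : FreeNS k I n →ₗ[k] FreeNS K I n :=
  Finsupp.mapRange.linearMap (Algebra.linearMap k K)

@[simp]
theorem FreeNS.extend_single {n : ℕ} (t : TreeMonomial I n) (c : k) :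
    FreeNS.extend K n (Finsupp.single t c) = Finsupp.single t (algebraMap k K c) := by
  simp [FreeNS.extend]

theorem FreeNS.extend_comp {m n : ℕ} (i : Fin m) (f : FreeNS k I m) (g : FreeNS k I n) :
    FreeNS.extend K _ (FreeNS.comp i f g) =
      FreeNS.comp i (FreeNS.extend K m f) (FreeNS.extend K n g) := by
  induction f using Finsupp.induction_linear with
  | zero => simp
  | add f f' hf hf' => simp [hf, hf']
  | single t a =>
    induction g using Finsupp.induction_linear with
    | zero => simp
    | add g g' hg hg' => simp [hg, hg']
    | single s b =>
      rw [FreeNS.comp_single, FreeNS.extend_single, FreeNS.extend_single, FreeNS.extend_single,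
        FreeNS.comp_single, map_mul]

/-- The `K`-span of the image of a `k`-subspace. -/
noncomputable def FreeNS.extendSubmodule {n : ℕ} (W : Submodule k (FreeNS k I n)) :
    Submodule K (FreeNS K I n) :=
  Submodule.span K (FreeNS.extend (k := k) (I := I) K n '' W)

theorem FreeNS.extend_mem_extendSubmodule {n : ℕ} {W : Submodule k (FreeNS k I n)}
    {f : FreeNS k I n} (hf : f ∈ W) : FreeNS.extend K n f ∈ FreeNS.extendSubmodule K W :=
  Submodule.subset_span ⟨f, hf, rfl⟩

theorem FreeNS.extendSubmodule_le {n : ℕ} {W : Submodule k (FreeNS k I n)}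
    {N : Submodule K (FreeNS K I n)} (h : ∀ f ∈ W, FreeNS.extend K n f ∈ N) :
    FreeNS.extendSubmodule K W ≤ N :=
  Submodule.span_le.2 (Set.image_subset_iff.2 h)

theorem FreeNS.comp_extend_mem {m n : ℕ} {N : Submodule K (FreeNS K I (m + n - 1))} (i : Fin m)
    {S : Set (FreeNS k I m)} {T : Set (FreeNS k I n)}
    (h : ∀ f ∈ S, ∀ g ∈ T, FreeNS.extend K _ (FreeNS.comp i f g) ∈ N) {f : FreeNS K I m}
    {g : FreeNS K I n} (hf : f ∈ Submodule.span K (FreeNS.extend K m '' S))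
    (hg : g ∈ Submodule.span K (FreeNS.extend K n '' T)) : FreeNS.comp i f g ∈ N := by
  induction hf, hg using Submodule.span_induction₂ with
  | mem_mem x y hx hy =>
    obtain ⟨x, hx, rfl⟩ := hx
    obtain ⟨y, hy, rfl⟩ := hy
    rw [← FreeNS.extend_comp]
    exact h x hx y hy
  | zero_left => simp
  | zero_right => simp
  | add_left x y z _ _ _ hx hy => rw [map_add]; exact add_mem hx hy
  | add_right x y z _ _ _ hx hy => rw [map_add]; exact add_mem hx hy
  | smul_left r x y _ _ h => rw [map_smul]; exact N.smul_mem r h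
  | smul_right r x y _ _ h => rw [map_smul]; exact N.smul_mem r h

theorem FreeNS.mem_span_extend_univ {n : ℕ} (f : FreeNS K I n) :
    f ∈ Submodule.span K (FreeNS.extend (k := k) K n '' Set.univ) := by
  induction f using Finsupp.induction_linear with
  | zero => exact zero_mem _
  | add f g hf hg => exact add_mem hf hg
  | single t c =>
    have h : Finsupp.single t c = c • FreeNS.extend (k := k) K n (Finsupp.single t 1) := by simp
    rw [h]
    exact Submodule.smul_mem _ _ (Submodule.subset_span ⟨_, trivial, rfl⟩)

theorem IsOperadicIdeal.extendSubmodule {J : (n : ℕ) → Submodule k (FreeNS k I n)}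
    (hJ : IsOperadicIdeal J) : IsOperadicIdeal fun n => FreeNS.extendSubmodule K (J n) where
  comp_left i _ g hf := FreeNS.comp_extend_mem (k := k) K i
    (fun f hf g _ => FreeNS.extend_mem_extendSubmodule K (hJ.comp_left i f g hf)) hf
    (FreeNS.mem_span_extend_univ (k := k) K g)
  comp_right i f _ hg := FreeNS.comp_extend_mem (k := k) K i
    (fun f _ g hg => FreeNS.extend_mem_extendSubmodule K (hJ.comp_right i f g hg))
    (FreeNS.mem_span_extend_univ (k := k) K f) hg

/-- Minimality is used on both sides: the extension of an ideal is an ideal over `K`, and the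
preimage of an ideal over `K` is an ideal over `k`. -/
theorem quadraticIdeal_extendSubmodule (R : Submodule k (FreeNS k I 3)) (n : ℕ) :
    quadraticIdeal (FreeNS.extendSubmodule K R) n =
      FreeNS.extendSubmodule K (quadraticIdeal R n) := by
  apply le_antisymm
  · exact quadraticIdeal_le ((isOperadicIdeal_quadraticIdeal R).extendSubmodule K)
      (Submodule.span_mono (Set.image_mono (le_quadraticIdeal R))) n
  · have hK := isOperadicIdeal_quadraticIdeal (FreeNS.extendSubmodule K R)
    have h : IsOperadicIdeal fun n =>
        ((quadraticIdeal (FreeNS.extendSubmodule K R) n).restrictScalars k).comap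
          (FreeNS.extend K n) :=
      { comp_left := fun i f g hf => by
          rw [Submodule.mem_comap, FreeNS.extend_comp]
          exact hK.comp_left i _ _ hf
        comp_right := fun i f g hg => by
          rw [Submodule.mem_comap, FreeNS.extend_comp]
          exact hK.comp_right i _ _ hg }
    exact FreeNS.extendSubmodule_le K fun f hf => quadraticIdeal_le h
      (fun r hr => le_quadraticIdeal _ (FreeNS.extend_mem_extendSubmodule K hr)) n hf

variable [Finite I]

theorem finrank_extendSubmodule {n : ℕ} (W : Submodule k (FreeNS k I n)) :
    Module.finrank K (FreeNS.extendSubmodule K W) = Module.finrank k W :=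
  finrank_span_mapRange_algebraMap K W

theorem finrank_quadraticNS_extend (R : Submodule k (FreeNS k I 3)) (n : ℕ) :
    Module.finrank K (QuadraticNS (FreeNS.extendSubmodule K R) n) =
      Module.finrank k (QuadraticNS R n) := by
  have h1 := (quadraticIdeal (FreeNS.extendSubmodule K R) n).finrank_quotient_add_finrank
  have h2 := (quadraticIdeal R n).finrank_quotient_add_finrank
  have h3 := finrank_extendSubmodule K (quadraticIdeal R n)
  have h4 : Module.finrank K (FreeNS K I n) = Module.finrank k (FreeNS k I n) := by
    simp [Module.finrank]
  change Module.finrank K (FreeNS K I n ⧸ quadraticIdeal _ n) =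
    Module.finrank k (FreeNS k I n ⧸ quadraticIdeal R n)
  rw [h4, ← h2, quadraticIdeal_extendSubmodule, h3] at h1
  rw [quadraticIdeal_extendSubmodule]
  exact Nat.add_right_cancel h1

end BaseChange

/-! ### Dimensions over an arbitrary field -/

theorem extend_maninRelation {k : Type*} [Field k] (K : Type*) [Field K] [Algebra k K] (ε : k) :
    FreeNS.extend K 3 (maninRelation ε) = maninRelation (algebraMap k K ε) := by
  simp only [maninRelation, map_sub, map_smul, FreeNS.extend_single, map_one, algebraMap_smul]

theorem finrank_quadraticNS_maninRelation {k : Type*} [Field k] {ε : k} (hε : ε ≠ 0) (n : ℕ) :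
    Module.finrank k (QuadraticNS (Submodule.span k {maninRelation ε}) n) = normalCount n := by
  let K := AlgebraicClosure k
  obtain ⟨i, hi⟩ := IsAlgClosed.exists_pow_nat_eq (algebraMap k K ε) (n := 2) Nat.two_pos
  have hi0 : i ≠ 0 := by
    rintro rfl
    exact hε ((map_eq_zero (algebraMap k K)).1 (by rw [← hi]; simp))
  rw [← finrank_quadraticNS_extend K, ← finrank_quadraticNS_of_square hi0 n]
  have h : FreeNS.extendSubmodule K (Submodule.span k {maninRelation ε}) =
      Submodule.span K {maninRelation (i * i)} := by
    rw [← sq, hi, ← extend_maninRelation]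
    apply le_antisymm
    · refine FreeNS.extendSubmodule_le K fun f hf => ?_
      obtain ⟨c, rfl⟩ := Submodule.mem_span_singleton.1 hf
      rw [map_smul, ← algebraMap_smul K]
      exact Submodule.smul_mem _ _ (Submodule.mem_span_singleton_self _)
    · rw [Submodule.span_singleton_le_iff_mem]
      exact Submodule.subset_span ⟨_, Submodule.mem_span_singleton_self _, rfl⟩
  rw [h]

theorem finrank_nonComFlex (k : Type*) [Field k] (n : ℕ) :
    Module.finrank k (NonComFlex k n) = normalCount n := by
  change Module.finrank k (QuadraticNS (LinearMap.ker (maninProjection (flexIdentity k))) n) = _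
  rw [flexIdentity_eq, ker_maninProjection_associatorIdentity _ (by ring)]
  exact finrank_quadraticNS_maninRelation (by simp) n

theorem finrank_nonComAntiFlex (k : Type*) [Field k] (n : ℕ) :
    Module.finrank k (NonComAntiFlex k n) = normalCount n := by
  change Module.finrank k (QuadraticNS (LinearMap.ker (maninProjection (antiFlexIdentity k))) n) = _
  rw [antiFlexIdentity_eq, ker_maninProjection_associatorIdentity _ (by ring)]
  exact finrank_quadraticNS_maninRelation (by simp) n

/-! ### Counting normal trees -/

section Counting

/-- The number of trees of arity `n` with the property `P`. -/
noncomputable def treeCount (P : PlanarTree ManinOp → Prop) (n : ℕ) : ℕ :=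
  Nat.card {t : PlanarTree ManinOp // P t ∧ t.arity = n}

theorem finite_treeCount (P : PlanarTree ManinOp → Prop) (n : ℕ) :
    Finite {t : PlanarTree ManinOp // P t ∧ t.arity = n} :=
  ((PlanarTree.finite_arity_le n).subset fun _ ht => le_of_eq ht.2).to_subtype

theorem treeCount_or {P P' Q : PlanarTree ManinOp → Prop} (h : ∀ t, P t ↔ P' t ∨ Q t)
    (hd : ∀ t, P' t → ¬Q t) (n : ℕ) : treeCount P n = treeCount P' n + treeCount Q n := by
  classical
  have := finite_treeCount P' n
  have := finite_treeCount Q n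
  rw [treeCount, treeCount, treeCount, ← Nat.card_sum]
  refine Nat.card_congr ((Equiv.subtypeEquivRight fun t => ?_).trans
    (subtypeOrEquiv _ _ (Pi.disjoint_iff.2 fun t => ?_)))
  · rw [h, or_and_right]
  · rw [Prop.disjoint_iff, not_and]
    exact fun h1 h2 => hd t h1.1 h2.1

theorem treeCount_leaf (n : ℕ) : treeCount (fun t => t = .leaf) n = if n = 1 then 1 else 0 := by
  rw [treeCount]
  split_ifs with h
  · subst h
    rw [Nat.card_eq_one_iff_unique]
    exact ⟨⟨fun a b => Subtype.ext (a.2.1.trans b.2.1.symm)⟩, ⟨⟨.leaf, rfl, rfl⟩⟩⟩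
  · rw [Nat.card_eq_zero]
    exact Or.inl ⟨fun ⟨t, ht, ht'⟩ => h (by rw [← ht', ht]; rfl)⟩

theorem treeCount_node (P Q : PlanarTree ManinOp → Prop) (o : ManinOp) (n : ℕ) :
    treeCount (fun t => ∃ l r, t = .node o l r ∧ P l ∧ Q r) n =
      ∑ p ∈ Finset.HasAntidiagonal.antidiagonal n, treeCount P p.1 * treeCount Q p.2 := by
  have hP := finite_treeCount P
  have hQ := finite_treeCount Q
  let F : (Σ p : Finset.HasAntidiagonal.antidiagonal n, {t // P t ∧ t.arity = p.1.1} × {t // Q t ∧ t.arity = p.1.2}) →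
      {t : PlanarTree ManinOp // (∃ l r, t = .node o l r ∧ P l ∧ Q r) ∧ t.arity = n} :=
    fun x => ⟨.node o x.2.1.1 x.2.2.1, ⟨_, _, rfl, x.2.1.2.1, x.2.2.2.1⟩, by
      rw [PlanarTree.arity, x.2.1.2.2, x.2.2.2.2]
      exact Finset.HasAntidiagonal.mem_antidiagonal.1 x.1.2⟩
  have hF : Function.Bijective F := by
    constructor
    · rintro ⟨⟨⟨i, j⟩, h⟩, ⟨l, hl, hl'⟩, ⟨r, hr, hr'⟩⟩ ⟨⟨⟨i', j'⟩, h'⟩, ⟨l', hl1, hl1'⟩, ⟨r', hr1, hr1'⟩⟩ e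
      have e' := congrArg Subtype.val e
      simp only [F, PlanarTree.node.injEq, true_and] at e'
      obtain ⟨rfl, rfl⟩ := e'
      dsimp only at hl' hr' hl1' hr1'
      subst hl' hr' hl1' hr1'
      rfl
    · rintro ⟨t, ⟨l, r, rfl, hl, hr⟩, ht⟩
      exact ⟨⟨⟨(l.arity, r.arity), Finset.HasAntidiagonal.mem_antidiagonal.2 ht⟩, ⟨l, hl, rfl⟩, ⟨r, hr, rfl⟩⟩, rfl⟩
  rw [treeCount, ← Nat.card_congr (Equiv.ofBijective F hF), Nat.card_sigma]
  simp only [Nat.card_prod]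
  exact Finset.sum_coe_sort _ fun p : ℕ × ℕ => treeCount P p.1 * treeCount Q p.2

/-- Normal trees whose root is not labelled by `≻`. -/
def PlanarTree.IsPrecNormal (t : PlanarTree ManinOp) : Prop :=
  t.IsNormal ∧ ¬t.IsSuccRooted

/-- Splitting by the root label: below `≻` both subtrees are arbitrary normal trees, giving `A = C +
A²`. -/
theorem normalCount_eq (n : ℕ) : normalCount n =
    treeCount PlanarTree.IsPrecNormal n +
      ∑ p ∈ Finset.HasAntidiagonal.antidiagonal n, normalCount p.1 * normalCount p.2 := by
  refine (treeCount_or (P := PlanarTree.IsNormal) (P' := PlanarTree.IsPrecNormal) (fun t => ?_)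
    (fun t ht => ?_) n).trans (congrArg _ (treeCount_node _ _ ManinOp.succ n))
  · match t with
    | .leaf => simp [PlanarTree.IsPrecNormal, PlanarTree.IsNormal, PlanarTree.IsSuccRooted]
    | .node .prec l r => simp [PlanarTree.IsPrecNormal, PlanarTree.IsSuccRooted]
    | .node .succ l r =>
      simp [PlanarTree.IsPrecNormal, PlanarTree.IsNormal, PlanarTree.IsSuccRooted]
  · rintro ⟨l, r, rfl, -⟩
    exact ht.2 trivial

/-- A leaf, or a root `≺` whose left subtree is again of this kind, giving `C = X + C A`. -/
theorem treeCount_isPrecNormal (n : ℕ) : treeCount PlanarTree.IsPrecNormal n =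
    (if n = 1 then 1 else 0) + ∑ p ∈ Finset.HasAntidiagonal.antidiagonal n,
      treeCount PlanarTree.IsPrecNormal p.1 * normalCount p.2 := by
  rw [← treeCount_leaf]
  refine (treeCount_or (fun t => ?_) (fun t ht => ?_) n).trans
    (congrArg _ (treeCount_node PlanarTree.IsPrecNormal PlanarTree.IsNormal ManinOp.prec n))
  · match t with
    | .leaf => simp [PlanarTree.IsPrecNormal, PlanarTree.IsNormal, PlanarTree.IsSuccRooted]
    | .node .prec l r =>
      simp [PlanarTree.IsPrecNormal, PlanarTree.IsNormal, PlanarTree.IsSuccRooted]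
    | .node .succ l r => simp [PlanarTree.IsPrecNormal, PlanarTree.IsSuccRooted]
  · rintro ⟨l, r, rfl, -⟩
    cases ht

-- Multiplying the equation by `T ^ r` gives `T ^ (r+1) = T ^ r + X T ^ (r+3)`, a recursion solved
-- by induction on `n` and then on `r`. The exponent is written `r + 1` because the closed form
-- fails at exponent `0`, `n = 0`.
open PowerSeries in
theorem coeff_pow_ternary {T : PowerSeries ℚ} (hT : T = 1 + X * T ^ 3) (n r : ℕ) :
    coeff n (T ^ (r + 1)) * (n.factorial * (2 * n + r + 1).factorial) =
      (r + 1) * (3 * n + r).factorial := by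
  have hrec : ∀ n r, coeff (n + 1) (T ^ (r + 1)) =
      coeff (n + 1) (T ^ r) + coeff n (T ^ (r + 3)) := fun n r => by
    rw [← coeff_succ_X_mul n (T ^ (r + 3)), ← map_add]
    congr 1
    linear_combination T ^ r * hT
  have hconst : constantCoeff T = 1 := by
    rw [hT]
    simp
  induction n generalizing r with
  | zero =>
    simp only [coeff_zero_eq_constantCoeff, map_pow, hconst]
    rw [show 2 * 0 + r + 1 = r + 1 by ring, Nat.factorial_succ]
    simp
  | succ n ih =>
    have h1 : ∀ m : ℕ, ((m + 1).factorial : ℚ) = (m + 1) * m.factorial := fun m => by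
      rw [Nat.factorial_succ]; push_cast; ring
    induction r with
    | zero =>
      have h := ih 2
      rw [hrec, pow_zero, coeff_one, if_neg (Nat.succ_ne_zero n), zero_add]
      rw [show 2 * (n + 1) + 0 + 1 = 2 * n + 2 + 1 by ring,
        show 3 * (n + 1) + 0 = 3 * n + 2 + 1 by ring, h1 n, h1 (3 * n + 2)]
      push_cast at h ⊢
      linear_combination (n + 1) * h
    | succ r ihr =>
      have h := ih (r + 3)
      rw [hrec]
      rw [show 2 * n + (r + 3) + 1 = 2 * n + r + 3 + 1 by ring,
        show 3 * n + (r + 3) = 3 * n + r + 3 by ring] at h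
      rw [show 2 * (n + 1) + r + 1 = 2 * n + r + 3 by ring,
        show 3 * (n + 1) + r = 3 * n + r + 3 by ring] at ihr
      rw [show 2 * (n + 1) + (r + 1) + 1 = 2 * n + r + 3 + 1 by ring,
        show 3 * (n + 1) + (r + 1) = 3 * n + r + 3 + 1 by ring, h1 (3 * n + r + 3)]
      rw [h1 (2 * n + r + 3), h1 n] at *
      push_cast at h ihr ⊢
      linear_combination (n + 1) * h + (2 * n + r + 4) * ihr

open PowerSeries in
theorem normalCount_mul_factorial (n : ℕ) :
    (normalCount (n + 1) : ℚ) * (n.factorial * (2 * n + 2).factorial) =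
      2 * (3 * n + 1).factorial := by
  let A : PowerSeries ℚ := mk fun n => (normalCount n : ℚ)
  let C : PowerSeries ℚ := mk fun n => (treeCount PlanarTree.IsPrecNormal n : ℚ)
  have hA : A = C + A * A := by
    ext n
    simp only [A, C, map_add, coeff_mul, coeff_mk]
    rw [normalCount_eq n]
    push_cast
    rfl
  have hC : C = X + C * A := by
    ext n
    simp only [A, C, map_add, coeff_mul, coeff_mk, coeff_X]
    rw [treeCount_isPrecNormal n]
    push_cast
    rfl
  have h0 : constantCoeff (1 - A) ≠ 0 := by
    have h : normalCount 0 = 0 := by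
      rw [normalCount, Nat.card_eq_zero]
      exact Or.inl ⟨fun t => t.1.arity_pos.ne' t.2.2⟩
    simp [A, ← coeff_zero_eq_constantCoeff, h]
  let T := (1 - A)⁻¹
  have hT1 : T * (1 - A) = 1 := PowerSeries.inv_mul_cancel _ h0
  -- Eliminate `C` from `C = A (1 - A)` and `C (1 - A) = X`.
  have hX : A * (1 - A) ^ 2 = X := by linear_combination (1 - A) * hA + hC
  have hAT : A = X * T ^ 2 := by
    rw [← hX]
    linear_combination (-A * (T * (1 - A) + 1)) * hT1
  have hT : T = 1 + X * T ^ 3 := by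
    linear_combination hT1 + T * hAT
  have h := coeff_pow_ternary hT n 1
  have e : coeff (n + 1) A = coeff n (T ^ 2) := by rw [hAT, coeff_succ_X_mul]
  rw [show (normalCount (n + 1) : ℚ) = coeff (n + 1) A by simp [A], e]
  norm_num at h ⊢
  exact h

end Counting

/-! ### The closed formulas -/

theorem normalCount_formulas (n : ℕ) (hn : 1 ≤ n) :
    (normalCount n : ℚ) = 1 / (n : ℚ) * ((3 * n - 2).choose (n - 1) : ℚ) ∧
      (normalCount n : ℚ) =
        ((3 * n - 2).factorial : ℚ) / ((n.factorial : ℚ) * ((2 * n - 1).factorial : ℚ)) := by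
  obtain ⟨n, rfl⟩ := Nat.exists_eq_add_of_le' hn
  have h := normalCount_mul_factorial n
  rw [show 3 * (n + 1) - 2 = 3 * n + 1 by omega, show 2 * (n + 1) - 1 = 2 * n + 1 by omega,
    Nat.add_sub_cancel]
  have h1 : ((2 * n + 2).factorial : ℚ) = (2 * n + 2) * (2 * n + 1).factorial := by
    rw [Nat.factorial_succ]; push_cast; ring
  have h2 : ((n + 1).factorial : ℚ) = (n + 1) * n.factorial := by
    rw [Nat.factorial_succ]; push_cast; ring
  have h3 : ((3 * n + 1).choose n : ℚ) * (n.factorial * (2 * n + 1).factorial) =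
      (3 * n + 1).factorial := by
    rw [← Nat.choose_mul_factorial_mul_factorial (show n ≤ 3 * n + 1 by omega),
      show 3 * n + 1 - n = 2 * n + 1 by omega]
    push_cast
    ring
  have hf : (n.factorial : ℚ) * (2 * n + 1).factorial ≠ 0 := by positivity
  have key : (normalCount (n + 1) : ℚ) * (n + 1) = (3 * n + 1).choose n := by
    apply mul_right_cancel₀ hf
    rw [h3]
    rw [h1] at h
    linear_combination h / 2
  have hn0 : (n : ℚ) + 1 ≠ 0 := by positivity
  constructor
  · push_cast
    rw [← key]
    field_simp
  · rw [h2, ← h3, ← key]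
    field_simp

theorem mainTheorem8 (k : Type*) [Field k] (n : ℕ) (hn : 1 ≤ n) :
    ((Module.finrank k (NonComFlex k n) : ℚ) = 1 / (n : ℚ) * ((3 * n - 2).choose (n - 1) : ℚ) ∧
      (Module.finrank k (NonComFlex k n) : ℚ) =
        ((3 * n - 2).factorial : ℚ) / ((n.factorial : ℚ) * ((2 * n - 1).factorial : ℚ))) ∧
    ((Module.finrank k (NonComAntiFlex k n) : ℚ) =
        1 / (n : ℚ) * ((3 * n - 2).choose (n - 1) : ℚ) ∧
      (Module.finrank k (NonComAntiFlex k n) : ℚ) =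
        ((3 * n - 2).factorial : ℚ) / ((n.factorial : ℚ) * ((2 * n - 1).factorial : ℚ))) := by
  rw [finrank_nonComFlex, finrank_nonComAntiFlex]
  exact ⟨normalCount_formulas n hn, normalCount_formulas n hn⟩
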